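/- Let $M$ be a compact connected smooth Riemannian manifold without boundary, with Riemannian distance $d(\cdot,\cdot)$ and Riemannian measure $m$. Fix a finite smooth atlas $(U_i,\chi_i)$ of $M$ together with compact sets $K_i\subset U_i$ that cover $M$, and for a $C^2$ map $f:M\to M$ let $\|f\|_{C^2}$ be the supremum of the norms of the first and second derivatives of $\chi_j\circ f\circ\chi_i^{-1}$ at $\chi_i(x)$, taken over all $i,j$ and all $x\in K_i$ with $f(x)\in K_j$. For real numbers $\lambda,\Gamma$ let $$\mathcal E(\lambda,\Gamma)=\{f:M\to M \text{ of class } C^2:\ \|f\|_{C^2}\le\Gamma,\ |Df(x)v|\ge\lambda|v| \text{ for all } x\in M,\ v\in T_xM\},$$ and let $$\mathcal D=\{\varphi:M\to(0,\infty):\ \varphi \text{ is Lipschitz with respect to } d,\ \textstyle\int\varphi\,dm=1\}.$$ For $f:M\to M$ the transfer operator is $$(\mathcal P_f\varphi)(x)=\sum_{y\in f^{-1}(x)}\frac{\varphi(y)}{|\det Df(y)|},$$ and for a sequence $f_1,f_2,\dots$ of maps put $F_n=f_n\circ\cdots\circ f_1$, $F_0=\mathrm{id}$. **Theorem.** Given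 $\lambda>1$ and $\Gamma$, there is a constant $\Lambda=\Lambda(\lambda,\Gamma)\in(0,1)$ (depending also on the fixed $M$ and the fixed atlas, but on nothing else) such that for all $\varphi,\psi\in\mathcal D$ there is a constant $C_{(\varphi,\psi)}$ such that, for every sequence $f_i\in\mathcal E(\lambda,\Gamma)$, $i\ge1$, and every $n\ge0$, the function $\mathcal P_{F_n}\varphi-\mathcal P_{F_n}\psi$ is $m$-integrable and $$\int|\mathcal P_{F_n}\varphi-\mathcal P_{F_n}\psi|\,dm\le C_{(\varphi,\psi)}\,\Lambda^n .$$ -/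

import Mathlib

open scoped Manifold ContDiff Bundle ENNReal
open MeasureTheory Bundle

noncomputable section

namespace ExpandingMaps

/-- The composition `F_n = f_n ∘ ⋯ ∘ f_1`, with `F_0 = id`. -/
def composition {M : Type*} (f : ℕ → M → M) : ℕ → M → M
  | 0 => id
  | n + 1 => f (n + 1) ∘ composition f n

/-- A finite atlas of a smooth `d`-manifold `M` (charts of the maximal smooth atlas), together with
compact subsets of the chart domains that still cover `M`.  Such data are what is needed to
measure `C^2` sizes of maps `M → M` in coordinates. -/
structure FiniteAtlas (d : ℕ) (M : Type*) [TopologicalSpace M]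
    [ChartedSpace (EuclideanSpace ℝ (Fin d)) M] where
  /-- the number of charts -/
  size : ℕ
  /-- the charts -/
  chart : Fin size → OpenPartialHomeomorph M (EuclideanSpace ℝ (Fin d))
  chart_mem : ∀ i, chart i ∈ IsManifold.maximalAtlas (𝓡 d) ∞ M
  /-- the compact pieces -/
  piece : Fin size → Set M
  isCompact_piece : ∀ i, IsCompact (piece i)
  piece_subset : ∀ i, piece i ⊆ (chart i).source
  cover : ⋃ i, piece i = Set.univ

section Coordinates

variable {d : ℕ} {M : Type*} [TopologicalSpace M] [ChartedSpace (EuclideanSpace ℝ (Fin d)) M]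

/-- The coordinate expression of `f : M → M` in the charts `i` (source) and `j` (target). -/
def FiniteAtlas.coord (A : FiniteAtlas d M) (i j : Fin A.size) (f : M → M) :
    EuclideanSpace ℝ (Fin d) → EuclideanSpace ℝ (Fin d) :=
  A.chart j ∘ f ∘ (A.chart i).symm

/-- The `C^2` size of a map `f : M → M`: the supremum of the operator norms of the first and second
derivatives of its coordinate expressions, over all pairs of charts `i`, `j` and all points `x` of
the `i`-th piece that `f` sends into the `j`-th piece.  There is no term of order zero: the values
of `f` lie in the compact space `M`, so such a term would be bounded anyway. -/
def FiniteAtlas.c2Norm (A : FiniteAtlas d M) (f : M → M) : ℝ≥0∞ :=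
  ⨆ (i : Fin A.size) (j : Fin A.size) (x : M) (_ : x ∈ A.piece i) (_ : f x ∈ A.piece j),
    max ‖iteratedFDeriv ℝ 1 (A.coord i j f) (A.chart i x)‖ₑ
      ‖iteratedFDeriv ℝ 2 (A.coord i j f) (A.chart i x)‖ₑ

end Coordinates

instance finiteDimensional_tangentSpace {d : ℕ} {M : Type*} [TopologicalSpace M]
    [ChartedSpace (EuclideanSpace ℝ (Fin d)) M] (x : M) :
    FiniteDimensional ℝ (TangentSpace (𝓡 d) x) :=
  inferInstanceAs (FiniteDimensional ℝ (EuclideanSpace ℝ (Fin d)))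

section Riemannian

variable (d : ℕ) {M : Type*} [TopologicalSpace M] [ChartedSpace (EuclideanSpace ℝ (Fin d)) M]
  [RiemannianBundle (fun x : M ↦ TangentSpace (𝓡 d) x)]

/-- The matrix `(g_ij)` of the Riemannian metric, in the preferred chart at `p`, at the point with
coordinates `u`: the Gram matrix of the coordinate vector fields. -/
def metricMatrix (p : M) (u : EuclideanSpace ℝ (Fin d)) : Matrix (Fin d) (Fin d) ℝ :=
  Matrix.gram ℝ (fun i : Fin d ↦
    (mfderiv (𝓡 d) (𝓡 d) (extChartAt (𝓡 d) p).symm u (EuclideanSpace.single i (1 : ℝ)) :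
      TangentSpace (𝓡 d) ((extChartAt (𝓡 d) p).symm u)))

/-- The Riemannian volume on the domain of the preferred chart at `p` (and zero outside): the image
of `√(det g_ij) du` on the target of the chart. -/
def chartVolume [MeasurableSpace M] (p : M) : Measure M :=
  (((volume : Measure (EuclideanSpace ℝ (Fin d))).restrict (extChartAt (𝓡 d) p).target).withDensity
    (fun u ↦ ENNReal.ofReal √(metricMatrix d p u).det)).map (extChartAt (𝓡 d) p).symm

/-- The Riemannian measure: the least measure that dominates the volume `√(det g_ij) du` of each
chart.  As these local volumes agree on overlaps of charts, it is the measure obtained by gluing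
them together. -/
def riemannianMeasure [MeasurableSpace M] : Measure M :=
  ⨆ p : M, chartVolume d p

/-- `|det Df(y)|`, the absolute value of the determinant of `Df(y) : T_y M → T_{f y} M` in
orthonormal bases of the two tangent spaces. -/
def absDet (f : M → M) (y : M) : ℝ :=
  LinearMap.normDet (𝕜 := ℝ) (U := TangentSpace (𝓡 d) y) (V := TangentSpace (𝓡 d) (f y))
    (mfderiv (𝓡 d) (𝓡 d) f y).toLinearMap

/-- The transfer operator `(P_f φ)(x) = ∑_{y ∈ f⁻¹ x} φ(y) / |det Df(y)|`. -/
def transferOperator (f : M → M) (φ : M → ℝ) (x : M) : ℝ :=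
  ∑ᶠ y ∈ f ⁻¹' {x}, φ y / absDet d f y

end Riemannian

/-- The class `ℰ(lam, Γ)` of `C^2` maps with `C^2` norm at most `Γ` and
`|Df(x) v| ≥ lam |v|` for all tangent vectors. -/
def expandingClass {d : ℕ} {M : Type*} [TopologicalSpace M]
    [ChartedSpace (EuclideanSpace ℝ (Fin d)) M]
    [RiemannianBundle (fun x : M ↦ TangentSpace (𝓡 d) x)]
    (A : FiniteAtlas d M) (lam Γ : ℝ) : Set (M → M) :=
  {f | ContMDiff (𝓡 d) (𝓡 d) 2 f ∧ A.c2Norm f ≤ ENNReal.ofReal Γ ∧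
    ∀ (x : M) (v : TangentSpace (𝓡 d) x), lam * ‖v‖ ≤ ‖mfderiv (𝓡 d) (𝓡 d) f x v‖}

/-- The class `𝒟` of strictly positive Lipschitz probability densities. -/
def densityClass (d : ℕ) (M : Type*) [MetricSpace M] [ChartedSpace (EuclideanSpace ℝ (Fin d)) M]
    [RiemannianBundle (fun x : M ↦ TangentSpace (𝓡 d) x)] [MeasurableSpace M] : Set (M → ℝ) :=
  {φ | (∀ x, 0 < φ x) ∧ ∫ x, φ x ∂(riemannianMeasure d : Measure M) = 1 ∧
    ∃ K, LipschitzWith K φ}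

end ExpandingMaps

end

/-! The proof is a coupling argument in cones of functions with Lipschitz logarithm. Write `J = |det
Df|`. The bound on two derivatives, together with `J ≥ 1`, makes `log J` Lipschitz with one constant
`K` for the whole class of maps (`exists_lipschitzWith_log_absDet`). Paths lift through `f` with
length divided by at least `lam`, which matches the fibres over two points injectively
(`exists_injective_fibre_map`). Hence the transfer operator turns log-Lipschitz constant `L` into
`(L + K) / lam` (`IsLogLipschitz.transferOperator`). By the change of variables formula it also
preserves integrals (`integral_transferOperator`).

Let two functions in the cone of constant `L` have the same mass. Each is at least `exp (-(L * diam
M))` times its mean, so one constant carrying a fixed fraction `κ` of the mass can be subtracted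
from both. Their difference is unchanged and the remainders have constant `(1 + δ) * L`
(`IsLogLipschitz.sub_const`). For small `δ` and large `L` the next operator brings them back into
the cone. After `n` rounds the mass left in each is `(1 - κ) ^ n` times the original, and the `L¹`
distance is at most twice that.

Arbitrary positive Lipschitz densities enter the cone after a number `N` of steps that depends only
on their log-Lipschitz constants. This delay is paid for by `C`, while the rate `1 - κ` depends only
on `lam`, `K` and the diameter of `M`. -/

noncomputable section

set_option linter.unusedSectionVars false

namespace ExpandingMaps

/-! ### Jacobians and volume densities of parametrizations. -/

section Density

open Topology

variable {d : ℕ} {M : Type*} [TopologicalSpace M] [ChartedSpace (EuclideanSpace ℝ (Fin d)) M]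

local notation "𝔼" => EuclideanSpace ℝ (Fin d)

/-- The image of the unit ball contains the unit ball, and its volume is `|A.det|` times as large.
-/
lemma one_le_abs_det {E : Type*} [NormedAddCommGroup E] [InnerProductSpace ℝ E]
    [FiniteDimensional ℝ E] (A : E →ₗ[ℝ] E) (hA : ∀ v, ‖v‖ ≤ ‖A v‖) : 1 ≤ |A.det| := by
  borelize E
  have hinj : Function.Injective A := by
    rw [injective_iff_map_eq_zero]
    intro v hv
    simpa [hv] using hA v
  have hsurj := LinearMap.injective_iff_surjective.1 hinj
  have h1 := Measure.addHaar_image_linearMap (volume : Measure E) A (Metric.ball 0 1)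
  have h2 : Metric.ball (0 : E) 1 ⊆ A '' Metric.ball 0 1 := by
    intro y hy
    obtain ⟨x, rfl⟩ := hsurj y
    refine ⟨x, ?_, rfl⟩
    rw [mem_ball_zero_iff] at hy ⊢
    exact (hA x).trans_lt hy
  have h3 := measure_mono (μ := (volume : Measure E)) h2
  rw [h1] at h3
  have hpos : (volume : Measure E) (Metric.ball 0 1) ≠ 0 :=
    (Metric.measure_ball_pos _ _ one_pos).ne'
  have hfin : (volume : Measure E) (Metric.ball 0 1) ≠ ⊤ := measure_ball_lt_top.ne
  have h4 : (1 : ℝ≥0∞) ≤ ENNReal.ofReal |A.det| := by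
    by_contra! hlt
    have := ENNReal.mul_lt_mul_left hpos hfin hlt
    rw [one_mul] at this
    exact absurd h3 (not_le.2 this)
  simpa using h4

lemma one_le_normDet {U V : Type*} [NormedAddCommGroup U] [InnerProductSpace ℝ U]
    [FiniteDimensional ℝ U] [NormedAddCommGroup V] [InnerProductSpace ℝ V]
    [FiniteDimensional ℝ V] (h : Module.finrank ℝ U = Module.finrank ℝ V) (A : U →ₗ[ℝ] V)
    (hA : ∀ v, ‖v‖ ≤ ‖A v‖) : 1 ≤ A.normDet := by
  let T : V ≃ₗᵢ[ℝ] U := (stdOrthonormalBasis ℝ V).equiv (stdOrthonormalBasis ℝ U) (finCongr h.symm)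
  have h1 := LinearMap.normDet_comp_of_finrank_eq A T.toLinearIsometry.toLinearMap h
  rw [T.toLinearIsometry.normDet_eq_one, one_mul] at h1
  rw [← h1, LinearMap.normDet_eq_norm_det]
  refine one_le_abs_det _ fun v ↦ ?_
  simpa using hA v

lemma finrank_tangentSpace (x : M) : Module.finrank ℝ (TangentSpace (𝓡 d) x) = d := by
  exact finrank_euclideanSpace_fin

lemma injective_mfderiv_symm [IsManifold (𝓡 d) ∞ M] {e : OpenPartialHomeomorph M 𝔼}
    (he : e ∈ IsManifold.maximalAtlas (𝓡 d) ∞ M) {u : 𝔼} (hu : u ∈ e.target) :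
    Function.Injective (mfderiv (𝓡 d) (𝓡 d) e.symm u) := by
  have h1 : MDifferentiableAt (𝓡 d) (𝓡 d) e.symm u :=
    (contMDiffAt_symm_of_mem_maximalAtlas he hu).mdifferentiableAt (by simp)
  have h2 : MDifferentiableAt (𝓡 d) (𝓡 d) e (e.symm u) :=
    (contMDiffAt_of_mem_maximalAtlas he (e.map_target hu)).mdifferentiableAt (by simp)
  have h3 : e ∘ e.symm =ᶠ[𝓝 u] id := by
    filter_upwards [e.open_target.mem_nhds hu] with v hv using e.right_inv hv
  have h4 := h3.mfderiv_eq (I := 𝓡 d) (I' := 𝓡 d)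
  rw [mfderiv_comp u h2 h1, mfderiv_id] at h4
  intro v w hvw
  have := congrArg (mfderiv (𝓡 d) (𝓡 d) e (e.symm u)) hvw
  rwa [← ContinuousLinearMap.comp_apply, ← ContinuousLinearMap.comp_apply, h4] at this

variable [RiemannianBundle (fun x : M ↦ TangentSpace (𝓡 d) x)]

/-- `normDet` of a linear map between model spaces, regarded as a map into the tangent space. -/
def tangentNormDet (x : M) (L : EuclideanSpace ℝ (Fin d) →L[ℝ] EuclideanSpace ℝ (Fin d)) : ℝ :=
  LinearMap.normDet (𝕜 := ℝ) (U := EuclideanSpace ℝ (Fin d)) (V := TangentSpace (𝓡 d) x)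
    L.toLinearMap

/-- The volume density of a parametrization `g` of `M`. -/
def density (g : EuclideanSpace ℝ (Fin d) → M) (u : EuclideanSpace ℝ (Fin d)) : ℝ :=
  tangentNormDet (g u) (mfderiv (𝓡 d) (𝓡 d) g u)

lemma density_nonneg (g : 𝔼 → M) (u : 𝔼) : 0 ≤ density g u := LinearMap.normDet_nonneg _

lemma absDet_nonneg (f : M → M) (y : M) : 0 ≤ absDet d f y := LinearMap.normDet_nonneg _

lemma density_congr {g g' : 𝔼 → M} {u : 𝔼} (h : g =ᶠ[𝓝 u] g') : density g u = density g' u := by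
  unfold density
  rw [h.mfderiv_eq, h.eq_of_nhds]

/-- The square of `normDet` is a Gram determinant. This replaces the metric matrix by a quantity
that obeys the chain rule. -/
lemma sqrt_det_metricMatrix (p : M) (u : 𝔼) :
    √(metricMatrix d p u).det = density (extChartAt (𝓡 d) p).symm u := by
  have h := LinearMap.normDet_sq_eq_det_gram (𝕜 := ℝ) (U := EuclideanSpace ℝ (Fin d))
    (V := TangentSpace (𝓡 d) ((extChartAt (𝓡 d) p).symm u))
    (mfderiv (𝓡 d) (𝓡 d) (extChartAt (𝓡 d) p).symm u).toLinearMap (EuclideanSpace.basisFun (Fin d) ℝ)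
  have h2 : (metricMatrix d p u).det = (density (extChartAt (𝓡 d) p).symm u)^2 := by
    symm
    refine Eq.trans h ?_
    unfold metricMatrix
    congr 2
    funext i
    rw [EuclideanSpace.basisFun_apply]
    rfl
  rw [h2, Real.sqrt_sq]
  exact LinearMap.normDet_nonneg _

lemma density_comp_left {f : M → M} {g : 𝔼 → M} {u : 𝔼} (hf : MDifferentiableAt (𝓡 d) (𝓡 d) f (g u))
    (hg : MDifferentiableAt (𝓡 d) (𝓡 d) g u) :
    density (f ∘ g) u = absDet d f (g u) * density g u := by
  unfold density
  rw [mfderiv_comp u hf hg]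
  exact LinearMap.normDet_comp_of_finrank_eq (U := EuclideanSpace ℝ (Fin d))
    (V := TangentSpace (𝓡 d) (g u)) (W := TangentSpace (𝓡 d) (f (g u))) _ _
    (by simp [finrank_tangentSpace])

lemma density_comp_right {g : 𝔼 → M} {h : 𝔼 → 𝔼} {u : 𝔼}
    (hg : MDifferentiableAt (𝓡 d) (𝓡 d) g (h u)) (hh : DifferentiableAt ℝ h u) :
    density (g ∘ h) u = density g (h u) * |(fderiv ℝ h u).det| := by
  unfold density
  rw [mfderiv_comp u hg hh.mdifferentiableAt]
  have := LinearMap.normDet_comp_of_finrank_eq (𝕜 := ℝ) (U := EuclideanSpace ℝ (Fin d))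
    (V := EuclideanSpace ℝ (Fin d)) (W := TangentSpace (𝓡 d) (g (h u)))
    (fderiv ℝ h u).toLinearMap (mfderiv (𝓡 d) (𝓡 d) g (h u)).toLinearMap rfl
  rw [LinearMap.normDet_eq_norm_det] at this
  rw [mfderiv_eq_fderiv]
  exact this

lemma absDet_comp {f g : M → M} {y : M} (hf : MDifferentiableAt (𝓡 d) (𝓡 d) f (g y))
    (hg : MDifferentiableAt (𝓡 d) (𝓡 d) g y) :
    absDet d (f ∘ g) y = absDet d f (g y) * absDet d g y := by
  unfold absDet
  rw [mfderiv_comp y hf hg]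
  exact LinearMap.normDet_comp_of_finrank_eq (U := TangentSpace (𝓡 d) y)
    (V := TangentSpace (𝓡 d) (g y)) (W := TangentSpace (𝓡 d) (f (g y))) _ _
    (by simp [finrank_tangentSpace])

lemma absDet_id (y : M) : absDet d (id : M → M) y = 1 := by
  unfold absDet
  rw [mfderiv_id]
  exact LinearMap.normDet_id (𝕜 := ℝ) (U := TangentSpace (𝓡 d) y)

lemma one_le_absDet {f : M → M} {y : M}
    (h : ∀ v : TangentSpace (𝓡 d) y, ‖v‖ ≤ ‖mfderiv (𝓡 d) (𝓡 d) f y v‖) : 1 ≤ absDet d f y :=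
  one_le_normDet (by simp [finrank_tangentSpace]) _ h

lemma density_pos {g : 𝔼 → M} {u : 𝔼}
    (h : Function.Injective (mfderiv (𝓡 d) (𝓡 d) g u)) : 0 < density g u := by
  refine lt_of_le_of_ne (LinearMap.normDet_nonneg _) fun h0 ↦ ?_
  exact (LinearMap.normDet_eq_zero_iff_ker_ne_bot.1 h0.symm) (LinearMap.ker_eq_bot.2 h)

lemma density_eq_sqrt (g : 𝔼 → M) (u : 𝔼) :
    density g u = √(Matrix.det (Matrix.of fun i j : Fin d ↦
      inner ℝ (mfderiv (𝓡 d) (𝓡 d) g u (EuclideanSpace.single i (1 : ℝ)) : TangentSpace (𝓡 d) (g u))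
      (mfderiv (𝓡 d) (𝓡 d) g u (EuclideanSpace.single j (1 : ℝ)) : TangentSpace (𝓡 d) (g u)))) := by
  have h := LinearMap.normDet_sq_eq_det_gram (𝕜 := ℝ) (U := EuclideanSpace ℝ (Fin d))
    (V := TangentSpace (𝓡 d) (g u))
    (mfderiv (𝓡 d) (𝓡 d) g u).toLinearMap (EuclideanSpace.basisFun (Fin d) ℝ)
  have h2 : Matrix.det (Matrix.of fun i j : Fin d ↦
      inner ℝ (mfderiv (𝓡 d) (𝓡 d) g u (EuclideanSpace.single i (1 : ℝ)) : TangentSpace (𝓡 d) (g u))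
      (mfderiv (𝓡 d) (𝓡 d) g u (EuclideanSpace.single j (1 : ℝ)) : TangentSpace (𝓡 d) (g u))) =
      density g u ^ 2 := by
    refine Eq.trans ?_ h.symm
    congr 1
    funext i j
    simp only [Matrix.gram, EuclideanSpace.basisFun_apply]
    rfl
  rw [h2, Real.sqrt_sq]
  exact LinearMap.normDet_nonneg _

section Smooth


variable [IsManifold (𝓡 d) ∞ M] [IsContMDiffRiemannianBundle (𝓡 d) ∞ (EuclideanSpace ℝ (Fin d))
      (fun x : M ↦ TangentSpace (𝓡 d) x)]

/-- The Gram determinant is a polynomial in inner products of `C^1` vector fields along `g`.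
Injectivity makes it positive, so the square root is harmless. -/
lemma contDiffAt_density {g : 𝔼 → M} {u : 𝔼} (hg : ContMDiffAt (𝓡 d) (𝓡 d) ∞ g u)
    (hinj : Function.Injective (mfderiv (𝓡 d) (𝓡 d) g u)) : ContDiffAt ℝ 1 (density g) u := by
  have key (i : Fin d) : ContMDiffAt (𝓡 d) ((𝓡 d).prod (𝓡 d)) 1
      (fun u ↦ (⟨g u, mfderiv (𝓡 d) (𝓡 d) g u (EuclideanSpace.single i (1 : ℝ))⟩ :
        TangentBundle (𝓡 d) M)) u := by
    have hϕ := hg.mfderiv_const (m := 1) (one_add_one_eq_two.trans_le ENat.LEInfty.out)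
    have hv : ContMDiffAt (𝓡 d) ((𝓡 d).prod (𝓡 d)) 1
        (fun u ↦ (⟨u, EuclideanSpace.single i (1 : ℝ)⟩ : TangentBundle (𝓡 d) 𝔼)) u := by
      exact contMDiffAt_vectorSpace_iff_contDiffAt.2 contDiffAt_const
    exact ContMDiffAt.clm_apply_of_inCoordinates hϕ hv (hg.of_le (by simp))
  have : IsContMDiffRiemannianBundle (𝓡 d) 1 (EuclideanSpace ℝ (Fin d))
      (fun x : M ↦ TangentSpace (𝓡 d) x) := .of_le (n := ∞) (by simp)
  have h2 (i j : Fin d) : ContMDiffAt (𝓡 d) 𝓘(ℝ) 1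
    (fun u ↦ inner ℝ (mfderiv (𝓡 d) (𝓡 d) g u (EuclideanSpace.single i (1 : ℝ)) : TangentSpace (𝓡 d) (g u))
      (mfderiv (𝓡 d) (𝓡 d) g u (EuclideanSpace.single j (1 : ℝ)) : TangentSpace (𝓡 d) (g u))) u :=
    ContMDiffAt.inner_bundle (F := EuclideanSpace ℝ (Fin d)) (key i) (key j)
  have h3 : density g = fun u ↦ √(∑ σ : Equiv.Perm (Fin d), Equiv.Perm.sign σ • ∏ i,
      inner ℝ (mfderiv (𝓡 d) (𝓡 d) g u (EuclideanSpace.single (σ i) (1 : ℝ)) : TangentSpace (𝓡 d) (g u))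
      (mfderiv (𝓡 d) (𝓡 d) g u (EuclideanSpace.single i (1 : ℝ)) : TangentSpace (𝓡 d) (g u))) := by
    funext u
    rw [density_eq_sqrt, Matrix.det_apply]
    rfl
  rw [h3]
  refine ContDiffAt.sqrt ?_ ?_
  · refine ContDiffAt.sum fun σ _ ↦ ContDiffAt.const_smul _ ?_
    exact contDiffAt_prod fun i _ ↦ (h2 _ _).contDiffAt
  · intro h0
    have := congrFun h3 u
    simp only [h0, Real.sqrt_zero] at this
    exact (density_pos hinj).ne' this

end Smooth

end Density

/-! ### The Riemannian measure in charts and change of variables. -/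

section LocalVolume

open Topology Set

variable {d : ℕ} {M : Type*} [MetricSpace M] [CompactSpace M]
  [MeasurableSpace M] [BorelSpace M]
  [ChartedSpace (EuclideanSpace ℝ (Fin d)) M] [IsManifold (𝓡 d) ∞ M]
  [RiemannianBundle (fun x : M ↦ TangentSpace (𝓡 d) x)]
  [IsContMDiffRiemannianBundle (𝓡 d) ∞ (EuclideanSpace ℝ (Fin d))
      (fun x : M ↦ TangentSpace (𝓡 d) x)]

local notation "𝔼" => EuclideanSpace ℝ (Fin d)

/-- The Riemannian volume on the domain of a chart. -/
def localVolume (e : OpenPartialHomeomorph M (EuclideanSpace ℝ (Fin d))) : Measure M :=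
  ((volume.restrict e.target).withDensity fun u ↦ ENNReal.ofReal (density e.symm u)).map e.symm

lemma chartVolume_eq_localVolume (p : M) : chartVolume d p = localVolume (chartAt 𝔼 p) := by
  unfold chartVolume localVolume
  simp only [sqrt_det_metricMatrix]
  have h : (extChartAt (𝓡 d) p).target = (chartAt 𝔼 p).target := by simp [extChartAt]
  rw [h]
  rfl

variable {e e' : OpenPartialHomeomorph M (EuclideanSpace ℝ (Fin d))}

lemma continuousOn_density (he : e ∈ IsManifold.maximalAtlas (𝓡 d) ∞ M) :
    ContinuousOn (density e.symm) e.target := fun _ hu ↦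
  (contDiffAt_density (contMDiffAt_symm_of_mem_maximalAtlas he hu)
    (injective_mfderiv_symm he hu)).continuousAt.continuousWithinAt

lemma image_eq_target_inter {S : Set M} (hSe : S ⊆ e.source) :
    e '' S = e.target ∩ e.symm ⁻¹' S := by
  ext u
  constructor
  · rintro ⟨x, hx, rfl⟩
    exact ⟨e.map_source (hSe hx), by simpa [e.left_inv (hSe hx)] using hx⟩
  · rintro ⟨hu, hx⟩
    exact ⟨e.symm u, hx, e.right_inv hu⟩

lemma measurableSet_chart_image {S : Set M} (hS : MeasurableSet S) (hSe : S ⊆ e.source) :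
    MeasurableSet (e '' S) :=
  hS.image_of_continuousOn_injOn (e.continuousOn.mono hSe) (e.injOn.mono hSe)

lemma setLIntegral_localVolume (he : e ∈ IsManifold.maximalAtlas (𝓡 d) ∞ M) {S : Set M}
    (hS : MeasurableSet S) (hSe : S ⊆ e.source) {F : M → ℝ≥0∞} (hF : Measurable F) :
    ∫⁻ x in S, F x ∂(localVolume e) =
      ∫⁻ u in e '' S, F (e.symm u) * ENNReal.ofReal (density e.symm u) := by
  have hsymm : AEMeasurable e.symm (volume.restrict e.target) :=
    e.continuousOn_symm.aemeasurable e.open_target.measurableSet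
  have hρ : AEMeasurable (fun u ↦ ENNReal.ofReal (density e.symm u)) (volume.restrict e.target) :=
    ((continuousOn_density he).aemeasurable e.open_target.measurableSet).ennreal_ofReal
  have hac := withDensity_absolutelyContinuous (volume.restrict e.target)
    (fun u ↦ ENNReal.ofReal (density e.symm u))
  rw [← lintegral_indicator hS]
  unfold localVolume
  rw [lintegral_map' (hF.indicator hS).aemeasurable (hsymm.mono_ac hac),
    lintegral_withDensity_eq_lintegral_mul₀ hρ
      (g := fun u ↦ S.indicator F (e.symm u)) ((hF.indicator hS).comp_aemeasurable hsymm)]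
  rw [← lintegral_indicator e.open_target.measurableSet,
    ← lintegral_indicator (measurableSet_chart_image hS hSe), image_eq_target_inter hSe]
  refine lintegral_congr fun u ↦ ?_
  by_cases hu : u ∈ e.target <;> by_cases hu' : e.symm u ∈ S <;>
    simp [indicator, hu, hu', mul_comm]

lemma differentiableAt_coord {f : M → M} {u : 𝔼} (he : e ∈ IsManifold.maximalAtlas (𝓡 d) ∞ M)
    (he' : e' ∈ IsManifold.maximalAtlas (𝓡 d) ∞ M) (hu : u ∈ e.target)
    (hfu : f (e.symm u) ∈ e'.source) (hf : MDifferentiableAt (𝓡 d) (𝓡 d) f (e.symm u)) :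
    DifferentiableAt ℝ (e' ∘ f ∘ e.symm) u := by
  have h1 : MDifferentiableAt (𝓡 d) (𝓡 d) e.symm u :=
    (contMDiffAt_symm_of_mem_maximalAtlas he hu).mdifferentiableAt (by simp)
  have h2 : MDifferentiableAt (𝓡 d) (𝓡 d) e' (f (e.symm u)) :=
    (contMDiffAt_of_mem_maximalAtlas he' hfu).mdifferentiableAt (by simp)
  exact (h2.comp u (hf.comp u h1)).differentiableAt

/-- The local formula for the Jacobian in charts. -/
lemma density_mul_abs_det {f : M → M} {u : 𝔼} (he : e ∈ IsManifold.maximalAtlas (𝓡 d) ∞ M)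
    (he' : e' ∈ IsManifold.maximalAtlas (𝓡 d) ∞ M) (hu : u ∈ e.target)
    (hfu : f (e.symm u) ∈ e'.source) (hf : MDifferentiableAt (𝓡 d) (𝓡 d) f (e.symm u)) :
    density e'.symm (e' (f (e.symm u))) * |(fderiv ℝ (e' ∘ f ∘ e.symm) u).det| =
      absDet d f (e.symm u) * density e.symm u := by
  have h1 : MDifferentiableAt (𝓡 d) (𝓡 d) e.symm u :=
    (contMDiffAt_symm_of_mem_maximalAtlas he hu).mdifferentiableAt (by simp)
  rw [← density_comp_left hf h1]
  have h2 : MDifferentiableAt (𝓡 d) (𝓡 d) e'.symm ((e' ∘ f ∘ e.symm) u) :=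
    (contMDiffAt_symm_of_mem_maximalAtlas he' (e'.map_source hfu)).mdifferentiableAt (by simp)
  have h3 := density_comp_right h2 (differentiableAt_coord he he' hu hfu hf)
  refine h3.symm.trans (density_congr ?_)
  have hc : ContinuousAt (f ∘ e.symm) u := (hf.comp u h1).continuousAt
  filter_upwards [hc.preimage_mem_nhds (e'.open_source.mem_nhds hfu)] with v hv
  exact e'.left_inv hv

/-- This is the Euclidean change of variables for `e' ∘ f ∘ e.symm`; `density_mul_abs_det` converts
the coordinate determinant into the Riemannian one. -/
lemma setLIntegral_image_localVolume {f : M → M} (he : e ∈ IsManifold.maximalAtlas (𝓡 d) ∞ M)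
    (he' : e' ∈ IsManifold.maximalAtlas (𝓡 d) ∞ M) {S : Set M} (hS : MeasurableSet S)
    (hSe : S ⊆ e.source) (hfS : f '' S ⊆ e'.source) (hinj : InjOn f S)
    (hf : MDifferentiable (𝓡 d) (𝓡 d) f) (hJ : Measurable (absDet d f)) {F : M → ℝ≥0∞}
    (hF : Measurable F) :
    ∫⁻ x in f '' S, F x ∂(localVolume e') =
      ∫⁻ y in S, F (f y) * ENNReal.ofReal (absDet d f y) ∂(localVolume e) := by
  have hfc : Continuous f := hf.continuous
  rw [setLIntegral_localVolume he' (hS.image_of_continuousOn_injOn hfc.continuousOn hinj) hfS hF,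
    setLIntegral_localVolume he hS hSe
      (F := fun y ↦ F (f y) * ENNReal.ofReal (absDet d f y)) ((hF.comp hfc.measurable).mul hJ.ennreal_ofReal)]
  have himg : e' '' (f '' S) = (e' ∘ f ∘ e.symm) '' (e '' S) := by
    rw [← image_comp, ← image_comp]
    refine image_congr fun x hx ↦ ?_
    simp [e.left_inv (hSe hx)]
  have hmem {u : 𝔼} (hu : u ∈ e '' S) : u ∈ e.target ∧ e.symm u ∈ S := by
    rwa [image_eq_target_inter hSe] at hu
  rw [himg, lintegral_image_eq_lintegral_abs_det_fderiv_mul volume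
    (measurableSet_chart_image hS hSe) (f' := fderiv ℝ (e' ∘ f ∘ e.symm))]
  · refine setLIntegral_congr_fun (measurableSet_chart_image hS hSe) fun u hu ↦ ?_
    obtain ⟨hu1, hu2⟩ := hmem hu
    have h3 := density_mul_abs_det he he' hu1 (hfS (mem_image_of_mem f hu2)) (hf _)
    simp only [Function.comp_apply]
    rw [e'.left_inv (hfS (mem_image_of_mem f hu2)), mul_comm, mul_assoc, mul_assoc,
      ← ENNReal.ofReal_mul (density_nonneg _ _),
      ← ENNReal.ofReal_mul (absDet_nonneg _ _), ← h3]
  · intro u hu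
    obtain ⟨hu1, hu2⟩ := hmem hu
    exact (differentiableAt_coord he he' hu1 (hfS (mem_image_of_mem f hu2))
      (hf _)).hasFDerivAt.hasFDerivWithinAt
  · intro u hu v hv huv
    obtain ⟨hu1, hu2⟩ := hmem hu
    obtain ⟨hv1, hv2⟩ := hmem hv
    have h1 := e'.injOn (hfS (mem_image_of_mem f hu2)) (hfS (mem_image_of_mem f hv2)) huv
    exact e.symm.injOn hu1 hv1 (hinj hu2 hv2 h1)

lemma localVolume_apply_eq (he : e ∈ IsManifold.maximalAtlas (𝓡 d) ∞ M)
    (he' : e' ∈ IsManifold.maximalAtlas (𝓡 d) ∞ M) {S : Set M} (hS : MeasurableSet S)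
    (hSe : S ⊆ e.source) (hSe' : S ⊆ e'.source) : localVolume e' S = localVolume e S := by
  have hJ : absDet d (id : M → M) = fun _ ↦ 1 := funext absDet_id
  have h := setLIntegral_image_localVolume (f := id) (F := fun _ ↦ 1) he he' hS hSe (by simpa)
    (injOn_id S) mdifferentiable_id (hJ ▸ measurable_const) measurable_const
  simpa [absDet_id] using h

lemma localVolume_compl_source : localVolume e e.sourceᶜ = 0 := by
  have hsymm : AEMeasurable e.symm (volume.restrict e.target) :=
    e.continuousOn_symm.aemeasurable e.open_target.measurableSet
  have hac := withDensity_absolutelyContinuous (volume.restrict e.target)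
    (fun u ↦ ENNReal.ofReal (density e.symm u))
  unfold localVolume
  rw [Measure.map_apply_of_aemeasurable (hsymm.mono_ac hac)
    e.open_source.measurableSet.compl]
  refine hac ?_
  refine le_antisymm ?_ bot_le
  have hsub : e.symm ⁻¹' e.sourceᶜ ⊆ e.targetᶜ := fun u h hu ↦ h (e.map_target hu)
  refine (measure_mono hsub).trans ?_
  rw [Measure.restrict_apply e.open_target.measurableSet.compl, compl_inter_self, measure_empty]

/-- A supremum of measures is hard to evaluate directly. Since chart volumes agree on overlaps, the
one at `p` dominates all the others on its own domain. -/
lemma restrict_riemannianMeasure_source (p : M) :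
    (riemannianMeasure d : Measure M).restrict (chartAt 𝔼 p).source = localVolume (chartAt 𝔼 p) := by
  have hp := IsManifold.chart_mem_maximalAtlas (I := 𝓡 d) (n := ∞) p
  have hpm : MeasurableSet (chartAt 𝔼 p).source := (chartAt 𝔼 p).open_source.measurableSet
  have key (q : M) :
      (localVolume (chartAt 𝔼 q)).restrict (chartAt 𝔼 p).source ≤ localVolume (chartAt 𝔼 p) := by
    have hqm : MeasurableSet (chartAt 𝔼 q).source := (chartAt 𝔼 q).open_source.measurableSet
    refine Measure.le_iff.2 fun S hS ↦ ?_
    rw [Measure.restrict_apply hS]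
    have h1 : localVolume (chartAt 𝔼 q) (S ∩ (chartAt 𝔼 p).source) =
        localVolume (chartAt 𝔼 q) ((S ∩ (chartAt 𝔼 p).source) ∩ (chartAt 𝔼 q).source) := by
      refine (measure_inter_conull ?_).symm
      exact localVolume_compl_source
    rw [h1, localVolume_apply_eq hp (IsManifold.chart_mem_maximalAtlas q)
      ((hS.inter hpm).inter hqm) (fun x hx ↦ hx.1.2) (fun x hx ↦ hx.2)]
    exact measure_mono fun x hx ↦ hx.1.1
  unfold riemannianMeasure
  simp only [chartVolume_eq_localVolume]
  refine le_antisymm ?_ ?_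
  · set m : Measure M := ⨆ q : M, localVolume (chartAt 𝔼 q) with hm
    -- The right side bounds every chart volume, hence the supremum; restricting to the chart domain
    -- then kills the second term.
    have hle : m ≤ localVolume (chartAt 𝔼 p) + m.restrict (chartAt 𝔼 p).sourceᶜ := by
      refine iSup_le fun q ↦ ?_
      rw [← Measure.restrict_add_restrict_compl (μ := localVolume (chartAt 𝔼 q)) hpm]
      exact add_le_add (key q) (Measure.restrict_mono le_rfl
        (le_iSup (fun q : M ↦ localVolume (chartAt 𝔼 q)) q))
    refine (Measure.restrict_mono le_rfl hle).trans ?_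
    rw [Measure.restrict_add, Measure.restrict_restrict hpm, inter_compl_self,
      Measure.restrict_empty, add_zero]
    exact Measure.restrict_le_self
  · refine le_trans ?_ (Measure.restrict_mono le_rfl
      (le_iSup (fun q : M ↦ localVolume (chartAt 𝔼 q)) p))
    rw [Measure.restrict_eq_self_of_ae_mem]
    exact localVolume_compl_source

lemma setLIntegral_riemannianMeasure {p : M} {S : Set M} (hS : S ⊆ (chartAt 𝔼 p).source)
    (F : M → ℝ≥0∞) :
    ∫⁻ x in S, F x ∂(riemannianMeasure d : Measure M) =
      ∫⁻ x in S, F x ∂(localVolume (chartAt 𝔼 p)) := by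
  rw [← restrict_riemannianMeasure_source p, Measure.restrict_restrict_of_subset hS]

lemma setLIntegral_image {f : M → M} {p q : M} {S : Set M} (hS : MeasurableSet S)
    (hSe : S ⊆ (chartAt 𝔼 p).source) (hfS : f '' S ⊆ (chartAt 𝔼 q).source) (hinj : InjOn f S)
    (hf : MDifferentiable (𝓡 d) (𝓡 d) f) (hJ : Measurable (absDet d f)) {F : M → ℝ≥0∞}
    (hF : Measurable F) :
    ∫⁻ x in f '' S, F x ∂(riemannianMeasure d : Measure M) =
      ∫⁻ y in S, F (f y) * ENNReal.ofReal (absDet d f y) ∂(riemannianMeasure d : Measure M) := by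
  rw [setLIntegral_riemannianMeasure hfS, setLIntegral_riemannianMeasure hSe,
    setLIntegral_image_localVolume (IsManifold.chart_mem_maximalAtlas p)
      (IsManifold.chart_mem_maximalAtlas q) hS hSe hfS hinj hf hJ hF]

instance isFiniteMeasure_riemannianMeasure : IsFiniteMeasure (riemannianMeasure d : Measure M) := by
  have : IsLocallyFiniteMeasure (riemannianMeasure d : Measure M) := by
    refine ⟨fun p ↦ ?_⟩
    set e := chartAt 𝔼 p
    have he : e ∈ IsManifold.maximalAtlas (𝓡 d) ∞ M := IsManifold.chart_mem_maximalAtlas p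
    have hp : p ∈ e.source := mem_chart_source 𝔼 p
    have hc : ContinuousAt (density e.symm) (e p) :=
      (continuousOn_density he).continuousAt (e.open_target.mem_nhds (e.map_source hp))
    obtain ⟨V, hVsub, hVo, hpV⟩ := mem_nhds_iff.1 (Filter.inter_mem
      (hc.eventually_lt_const (lt_add_one _)) (Metric.ball_mem_nhds (e p) one_pos))
    have hS : IsOpen (e.source ∩ e ⁻¹' V) := e.isOpen_inter_preimage hVo
    refine ⟨e.source ∩ e ⁻¹' V, hS.mem_nhds ⟨hp, hpV⟩, ?_⟩
    rw [← setLIntegral_one, setLIntegral_riemannianMeasure (inter_subset_left),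
      setLIntegral_localVolume he hS.measurableSet inter_subset_left measurable_const]
    have himg : e '' (e.source ∩ e ⁻¹' V) ⊆ V := by
      rintro _ ⟨x, hx, rfl⟩
      exact hx.2
    calc ∫⁻ u in e '' (e.source ∩ e ⁻¹' V), 1 * ENNReal.ofReal (density e.symm u)
        ≤ ∫⁻ u in V, ENNReal.ofReal (density e.symm u) := by
          simp only [one_mul]
          exact lintegral_mono_set himg
      _ ≤ ∫⁻ u in V, ENNReal.ofReal (density e.symm (e p) + 1) :=
          setLIntegral_mono' hVo.measurableSet fun u hu ↦
            ENNReal.ofReal_le_ofReal (hVsub hu).1.le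
      _ < ⊤ := by
          rw [setLIntegral_const]
          refine ENNReal.mul_lt_top ENNReal.ofReal_lt_top ?_
          exact (measure_mono fun u hu ↦ (hVsub hu).2).trans_lt measure_ball_lt_top
  exact ⟨isCompact_univ.measure_lt_top⟩

end LocalVolume

/-! ### Fibre sums, conservation of mass and composition of transfer operators. -/

section FibreSum

open Topology Set

/-- The sum of `H` over the fibre of `f` at `x`, in `[0, ∞]`. -/
def fibreSum {M N : Type*} (f : M → N) (H : M → ℝ≥0∞) (x : N) : ℝ≥0∞ :=
  ∑' y : f ⁻¹' {x}, H y

lemma fibreSum_add {M N : Type*} (f : M → N) (H H' : M → ℝ≥0∞) (x : N) :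
    fibreSum f (fun y ↦ H y + H' y) x = fibreSum f H x + fibreSum f H' x :=
  ENNReal.tsum_add

lemma fibreSum_eq_of_injOn {M N : Type*} {f : M → N} {H : M → ℝ≥0∞} {U : Set M} (hinj : InjOn f U)
    (hH : ∀ y ∉ U, H y = 0) {y : M} (hy : y ∈ U) : fibreSum f H (f y) = H y := by
  unfold fibreSum
  refine tsum_eq_single (⟨y, rfl⟩ : f ⁻¹' {f y}) fun z hz ↦ hH _ fun hzU ↦ hz ?_
  exact Subtype.ext (hinj hzU hy z.2)

lemma fibreSum_eq_zero {M N : Type*} {f : M → N} {H : M → ℝ≥0∞} {U : Set M}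
    (hH : ∀ y ∉ U, H y = 0) {x : N} (hx : x ∉ f '' U) : fibreSum f H x = 0 := by
  unfold fibreSum
  refine ENNReal.tsum_eq_zero.2 fun z ↦ hH _ fun hzU ↦ hx ⟨z, hzU, z.2⟩

lemma ofReal_finsum_mem {M : Type*} {s : Set M} (hs : s.Finite) {g : M → ℝ} (hg : ∀ y, 0 ≤ g y) :
    ENNReal.ofReal (∑ᶠ y ∈ s, g y) = ∑' y : s, ENNReal.ofReal (g y) := by
  have : Fintype s := hs.fintype
  rw [finsum_mem_eq_finite_toFinset_sum _ hs, ENNReal.ofReal_sum_of_nonneg fun y _ ↦ hg y,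
    tsum_fintype]
  rw [Finset.sum_subtype (F := inferInstance) hs.toFinset (fun x ↦ hs.mem_toFinset)]

variable {d : ℕ} {M : Type*} [MetricSpace M] [CompactSpace M]
  [MeasurableSpace M] [BorelSpace M]
  [ChartedSpace (EuclideanSpace ℝ (Fin d)) M] [IsManifold (𝓡 d) ∞ M]
  [RiemannianBundle (fun x : M ↦ TangentSpace (𝓡 d) x)]
  [IsContMDiffRiemannianBundle (𝓡 d) ∞ (EuclideanSpace ℝ (Fin d))
      (fun x : M ↦ TangentSpace (𝓡 d) x)]

local notation "𝔼" => EuclideanSpace ℝ (Fin d)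

/-- When `H` lives where `f` is injective, each fibre has at most one contributing point, and the
claim reduces to change of variables. -/
lemma lintegral_fibreSum_of_local {f : M → M} (hf : MDifferentiable (𝓡 d) (𝓡 d) f)
    (hJ : Measurable (absDet d f)) {p q : M} {Φ : OpenPartialHomeomorph M M}
    (hΦ : EqOn f Φ Φ.source) (hp : Φ.source ⊆ (chartAt 𝔼 p).source)
    (hq : f '' Φ.source ⊆ (chartAt 𝔼 q).source) {H : M → ℝ≥0∞} (hH : Measurable H)
    (hH0 : ∀ y ∉ Φ.source, H y = 0) :
    Measurable (fibreSum f H) ∧ ∫⁻ x, fibreSum f H x ∂(riemannianMeasure d : Measure M) =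
      ∫⁻ y, H y * ENNReal.ofReal (absDet d f y) ∂(riemannianMeasure d : Measure M) := by
  have hinj : InjOn f Φ.source := hΦ.injOn_iff.2 Φ.injOn
  have himg : f '' Φ.source = Φ.target := by rw [hΦ.image_eq, Φ.image_source_eq_target]
  have hU : MeasurableSet Φ.source := Φ.open_source.measurableSet
  have hV : MeasurableSet Φ.target := Φ.open_target.measurableSet
  have hmeas : Measurable (fibreSum f H) := by
    classical
    rcases isEmpty_or_nonempty M with hM | ⟨⟨z⟩⟩
    · exact measurable_of_empty _
    have hg : Measurable (Φ.target.piecewise Φ.symm fun _ ↦ z) :=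
      Φ.continuousOn_symm.measurable_piecewise continuousOn_const hV
    have heq : fibreSum f H = Φ.target.indicator
        (fun x ↦ H (Φ.target.piecewise Φ.symm (fun _ ↦ z) x)) := by
      funext x
      by_cases hx : x ∈ Φ.target
      · have h1 := fibreSum_eq_of_injOn hinj hH0 (Φ.map_target hx)
        rw [hΦ (Φ.map_target hx), Φ.right_inv hx] at h1
        simp [hx, h1]
      · rw [fibreSum_eq_zero hH0 (himg ▸ hx)]
        simp [hx]
    rw [heq]
    exact (hH.comp hg).indicator hV
  refine ⟨hmeas, ?_⟩
  have h1 : ∫⁻ x, fibreSum f H x ∂(riemannianMeasure d : Measure M) =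
      ∫⁻ x in f '' Φ.source, fibreSum f H x ∂(riemannianMeasure d : Measure M) := by
    rw [setLIntegral_eq_of_support_subset]
    intro x hx
    by_contra hx'
    exact hx (fibreSum_eq_zero hH0 hx')
  have h2 : ∫⁻ y, H y * ENNReal.ofReal (absDet d f y) ∂(riemannianMeasure d : Measure M) =
      ∫⁻ y in Φ.source, H y * ENNReal.ofReal (absDet d f y)
        ∂(riemannianMeasure d : Measure M) := by
    rw [setLIntegral_eq_of_support_subset]
    intro x hx
    by_contra hx'
    exact hx (by simp [hH0 x hx'])
  rw [h1, h2, setLIntegral_image hU hp hq hinj hf hJ hmeas]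
  exact setLIntegral_congr_fun hU fun y hy ↦ by
    simp only [fibreSum_eq_of_injOn hinj hH0 hy]

/-- Both sides are additive in `H`, so compactness reduces the identity to `H` supported in a small
set where `f` is a homeomorphism between chart domains. -/
lemma lintegral_fibreSum {f : M → M} (hf : MDifferentiable (𝓡 d) (𝓡 d) f)
    (hloc : IsLocalHomeomorph f) (hJ : Measurable (absDet d f)) {H : M → ℝ≥0∞}
    (hH : Measurable H) :
    ∫⁻ x, fibreSum f H x ∂(riemannianMeasure d : Measure M) =
      ∫⁻ y, H y * ENNReal.ofReal (absDet d f y) ∂(riemannianMeasure d : Measure M) := by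
  have main := isCompact_univ.induction_on (X := M) (p := fun s : Set M ↦ ∃ s', MeasurableSet s' ∧
    s ⊆ s' ∧ ∀ H : M → ℝ≥0∞, Measurable H → (∀ y ∉ s', H y = 0) → Measurable (fibreSum f H) ∧
      ∫⁻ x, fibreSum f H x ∂(riemannianMeasure d : Measure M) =
      ∫⁻ y, H y * ENNReal.ofReal (absDet d f y) ∂(riemannianMeasure d : Measure M)) ?_ ?_ ?_ ?_
  · obtain ⟨s', -, hs', h⟩ := main
    exact (h H hH fun y hy ↦ absurd (hs' (mem_univ y)) hy).2
  · refine ⟨∅, MeasurableSet.empty, le_rfl, fun H _ hH0 ↦ ?_⟩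
    have h0 : H = fun _ ↦ 0 := funext fun y ↦ hH0 y (notMem_empty y)
    have h1 : fibreSum f H = fun _ ↦ 0 := funext fun x ↦ by simp [fibreSum, h0]
    rw [h1]
    exact ⟨measurable_const, by simp [h0]⟩
  · rintro s t hst ⟨s', hs', hts, h⟩
    exact ⟨s', hs', hst.trans hts, h⟩
  · rintro s t ⟨s', hs', hss, h1⟩ ⟨t', ht', htt, h2⟩
    refine ⟨s' ∪ t', hs'.union ht', union_subset_union hss htt, fun H hH hH0 ↦ ?_⟩
    -- Cutting along `s'` and its complement avoids double counting on the overlap with `t'`.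
    have hsum : H = fun y ↦ s'.indicator H y + s'ᶜ.indicator H y :=
      funext fun y ↦ (indicator_self_add_compl_apply s' H y).symm
    obtain ⟨m1, e1⟩ := h1 (s'.indicator H) (hH.indicator hs') (fun y hy ↦ by simp [hy])
    obtain ⟨m2, e2⟩ := h2 (s'ᶜ.indicator H) (hH.indicator hs'.compl) (fun y hy ↦ by
      by_cases hys : y ∈ s'
      · simp [hys]
      · simp [hys, hH0 y (by simp [hys, hy])])
    have hfs : fibreSum f H = fun x ↦ fibreSum f (s'.indicator H) x +
        fibreSum f (s'ᶜ.indicator H) x := by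
      funext x
      conv_lhs => rw [hsum]
      exact fibreSum_add _ _ _ _
    rw [hfs]
    refine ⟨m1.add m2, ?_⟩
    rw [lintegral_add_left m1, e1, e2, ← lintegral_add_left]
    · refine lintegral_congr fun y ↦ ?_
      rw [← add_mul]
      congr 1
      exact indicator_self_add_compl_apply s' H y
    · exact (hH.indicator hs').mul hJ.ennreal_ofReal
  · intro y _
    obtain ⟨Φ, hy, rfl⟩ := hloc y
    have hW : IsOpen ((chartAt 𝔼 y).source ∩ Φ ⁻¹' (chartAt 𝔼 (Φ y)).source) :=
      (chartAt 𝔼 y).open_source.inter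
        ((chartAt 𝔼 (Φ y)).open_source.preimage hf.continuous)
    set Ψ := Φ.restrOpen _ hW with hΨ
    have hsrc : Ψ.source = Φ.source ∩ ((chartAt 𝔼 y).source ∩ Φ ⁻¹' (chartAt 𝔼 (Φ y)).source) :=
      Φ.restrOpen_source _ hW
    refine ⟨Ψ.source, ?_, Ψ.source, Ψ.open_source.measurableSet, le_rfl, fun H hH hH0 ↦ ?_⟩
    · rw [nhdsWithin_univ]
      refine Ψ.open_source.mem_nhds ?_
      rw [hsrc]
      exact ⟨hy, mem_chart_source 𝔼 y, mem_chart_source 𝔼 (Φ y)⟩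
    · refine lintegral_fibreSum_of_local (p := y) (q := Φ y) hf hJ (Φ := Ψ) (fun z _ ↦ rfl)
        ?_ ?_ hH hH0
      · rw [hsrc]
        exact fun z hz ↦ hz.2.1
      · rw [hsrc]
        rintro _ ⟨z, hz, rfl⟩
        exact hz.2.2

/-- The transfer operator preserves integrals. -/
lemma integral_transferOperator {f : M → M} (hf : MDifferentiable (𝓡 d) (𝓡 d) f)
    (hloc : IsLocalHomeomorph f) (hJ : Measurable (absDet d f)) (hpos : ∀ y, 0 < absDet d f y)
    (hfin : ∀ x, (f ⁻¹' {x}).Finite) {φ : M → ℝ} (hφ : Continuous φ) (hφ0 : ∀ y, 0 ≤ φ y)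
    (hP : Continuous (transferOperator d f φ)) :
    ∫ x, transferOperator d f φ x ∂(riemannianMeasure d : Measure M) =
      ∫ x, φ x ∂(riemannianMeasure d : Measure M) := by
  have hg (y : M) : 0 ≤ φ y / absDet d f y := div_nonneg (hφ0 y) (hpos y).le
  have hP0 (x : M) : 0 ≤ transferOperator d f φ x :=
    finsum_nonneg fun y ↦ finsum_nonneg fun _ ↦ hg y
  have h1 (x : M) : ENNReal.ofReal (transferOperator d f φ x) =
      fibreSum f (fun y ↦ ENNReal.ofReal (φ y / absDet d f y)) x :=
    ofReal_finsum_mem (hfin x) hg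
  rw [integral_eq_lintegral_of_nonneg_ae (Filter.Eventually.of_forall hP0)
      hP.aestronglyMeasurable,
    integral_eq_lintegral_of_nonneg_ae (Filter.Eventually.of_forall hφ0)
      hφ.aestronglyMeasurable]
  congr 1
  simp only [h1]
  rw [lintegral_fibreSum hf hloc hJ (H := fun y ↦ ENNReal.ofReal (φ y / absDet d f y))
    (hφ.measurable.div hJ).ennreal_ofReal]
  refine lintegral_congr fun y ↦ ?_
  rw [← ENNReal.ofReal_mul (hg y), div_mul_cancel₀ _ (hpos y).ne']

/-- A fibre of `f ∘ g` is the disjoint union of the fibres of `g` over a fibre of `f`, and Jacobians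
multiply. -/
lemma transferOperator_comp {f g : M → M} (hf : MDifferentiable (𝓡 d) (𝓡 d) f)
    (hg : MDifferentiable (𝓡 d) (𝓡 d) g) (hffin : ∀ x, (f ⁻¹' {x}).Finite)
    (hgfin : ∀ x, (g ⁻¹' {x}).Finite) (φ : M → ℝ) :
    transferOperator d (f ∘ g) φ = transferOperator d f (transferOperator d g φ) := by
  classical
  funext x
  unfold transferOperator
  have h1 : f ∘ g ⁻¹' {x} = ⋃ z ∈ f ⁻¹' {x}, g ⁻¹' {z} := by
    ext y
    simp
  rw [h1, finsum_mem_biUnion _ (hffin x) fun z _ ↦ hgfin z]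
  · refine finsum_mem_congr rfl fun z _ ↦ ?_
    rw [div_eq_mul_inv, finsum_mem_mul' _ _ (hgfin z)]
    refine finsum_mem_congr rfl fun y hy ↦ ?_
    have hy' : g y = z := hy
    rw [absDet_comp (hf _) (hg _), hy', div_eq_mul_inv, div_eq_mul_inv, mul_inv]
    ring
  · intro z _ z' _ hzz'
    refine disjoint_left.2 fun y hy hy' ↦ hzz' ?_
    exact Eq.trans (Eq.symm hy) hy'

end FibreSum

/-! ### Lipschitz estimates on a Riemannian manifold by means of paths. -/

section Lipschitz

open Topology Set Manifold
open scoped NNReal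

/-- `g` is Lipschitz with constant `C` on some neighbourhood of `x`. -/
def LipschitzNear {α β : Type*} [PseudoEMetricSpace α] [PseudoEMetricSpace β] (C : ℝ≥0)
    (g : α → β) (x : α) : Prop :=
  ∃ U ∈ 𝓝 x, LipschitzOnWith C g U

section

variable {α β γ : Type*} [PseudoEMetricSpace α] [PseudoEMetricSpace β] [PseudoEMetricSpace γ]
  {C C' : ℝ≥0} {x : α}

lemma LipschitzNear.mono {g : α → β} (h : LipschitzNear C g x) (hC : C ≤ C') :
    LipschitzNear C' g x :=
  let ⟨U, hU, hg⟩ := h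
  ⟨U, hU, hg.weaken hC⟩

lemma LipschitzNear.continuousAt {g : α → β} (h : LipschitzNear C g x) : ContinuousAt g x :=
  let ⟨_, hU, hg⟩ := h
  hg.continuousOn.continuousAt hU

lemma LipschitzNear.comp {g : β → γ} {f : α → β} (hg : LipschitzNear C' g (f x))
    (hf : LipschitzNear C f x) : LipschitzNear (C' * C) (g ∘ f) x := by
  have hc := hf.continuousAt
  obtain ⟨U, hU, hf⟩ := hf
  obtain ⟨V, hV, hg⟩ := hg
  refine ⟨U ∩ f ⁻¹' V, Filter.inter_mem hU (hc hV), ?_⟩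
  exact hg.comp (hf.mono inter_subset_left) (fun y hy ↦ hy.2)

lemma LipschitzNear.congr {g g' : α → β} (h : LipschitzNear C g x) (hgg' : g =ᶠ[𝓝 x] g') :
    LipschitzNear C g' x := by
  obtain ⟨U, hU, hg⟩ := h
  refine ⟨U ∩ {y | g y = g' y}, Filter.inter_mem hU hgg', fun y hy z hz ↦ ?_⟩
  rw [← hy.2, ← hz.2]
  exact hg hy.1 hz.1

lemma LipschitzNear.add {E : Type*} [SeminormedAddCommGroup E] {g g' : α → E}
    (h : LipschitzNear C g x) (h' : LipschitzNear C' g' x) :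
    LipschitzNear (C + C') (fun y ↦ g y + g' y) x := by
  obtain ⟨U, hU, hg⟩ := h
  obtain ⟨V, hV, hg'⟩ := h'
  exact ⟨U ∩ V, Filter.inter_mem hU hV,
    (hg.mono inter_subset_left).add (hg'.mono inter_subset_right)⟩

lemma LipschitzNear.neg {E : Type*} [SeminormedAddCommGroup E] {g : α → E}
    (h : LipschitzNear C g x) : LipschitzNear C (fun y ↦ -g y) x := by
  obtain ⟨U, hU, hg⟩ := h
  exact ⟨U, hU, hg.neg⟩

/-- Locally Lipschitz functions are uniformly so on compact sets. -/
lemma exists_forall_lipschitzNear {g : α → β} {K : Set α} (hK : IsCompact K)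
    (h : ∀ x ∈ K, ∃ C, LipschitzNear C g x) : ∃ C, ∀ x ∈ K, LipschitzNear C g x := by
  refine hK.induction_on (p := fun s ↦ ∃ C, ∀ x ∈ s, LipschitzNear C g x) ⟨0, by simp⟩ ?_ ?_ ?_
  · rintro s t hst ⟨C, hC⟩
    exact ⟨C, fun x hx ↦ hC x (hst hx)⟩
  · rintro s t ⟨C, hC⟩ ⟨C', hC'⟩
    refine ⟨max C C', fun x hx ↦ hx.elim (fun h ↦ ?_) fun h ↦ ?_⟩
    · exact (hC x h).mono (le_max_left _ _)
    · exact (hC' x h).mono (le_max_right _ _)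
  · intro x hx
    obtain ⟨C, U, hU, hg⟩ := h x hx
    exact ⟨interior U, mem_nhdsWithin_of_mem_nhds (interior_mem_nhds.2 hU), C,
      fun y hy ↦ ⟨U, mem_interior_iff_mem_nhds.1 hy, hg⟩⟩

end

/-- Distance is an infimum of path lengths that need not be attained, so estimates come for every
`r` above the distance. The cap `R` keeps the paths short. -/
lemma le_coe_mul_of_forall_gt {C : ℝ≥0} {a b R : ℝ≥0∞} (ha : a < R)
    (h : ∀ r, a < r → r ≤ R → b ≤ C * r) : b ≤ C * a := by
  have : (𝓝[>] a).NeBot := nhdsGT_neBot_of_exists_gt ⟨R, ha⟩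
  have ht : Filter.Tendsto (fun r : ℝ≥0∞ ↦ C * r) (𝓝[>] a) (𝓝 (C * a)) :=
    ((ENNReal.continuous_const_mul ENNReal.coe_ne_top).tendsto a).mono_left nhdsWithin_le_nhds
  refine ge_of_tendsto ht ?_
  filter_upwards [Ioo_mem_nhdsGT ha] with r hr using h r hr.1 hr.2.le

lemma ContDiffAt.lipschitzNear {E F : Type*} [NormedAddCommGroup E] [NormedSpace ℝ E]
    [NormedAddCommGroup F] [NormedSpace ℝ F] {g : E → F} {x : E} (hg : ContDiffAt ℝ 1 g x) :
    ∃ C, LipschitzNear C g x :=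
  let ⟨C, U, hU, h⟩ := hg.exists_lipschitzOnWith
  ⟨C, U, hU, h⟩

variable {d : ℕ} {M : Type*} [MetricSpace M]
  [ChartedSpace (EuclideanSpace ℝ (Fin d)) M] [IsManifold (𝓡 d) ∞ M]
  [RiemannianBundle (fun x : M ↦ TangentSpace (𝓡 d) x)]
  [IsRiemannianManifold (𝓡 d) M]

local notation "𝔼" => EuclideanSpace ℝ (Fin d)

variable (d) in
lemma exists_path_of_edist_lt {x y : M} {r : ℝ≥0∞} (h : edist x y < r) :
    ∃ γ : ℝ → M, γ 0 = x ∧ γ 1 = y ∧ ContMDiffOn 𝓘(ℝ) (𝓡 d) 1 γ (Icc 0 1) ∧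
      pathELength (𝓡 d) γ 0 1 < r := by
  rw [IsRiemannianManifold.out (I := 𝓡 d)] at h
  exact exists_lt_of_riemannianEDist_lt h

lemma edist_le_pathELength {γ : ℝ → M} (hγ : ContMDiffOn 𝓘(ℝ) (𝓡 d) 1 γ (Icc 0 1)) {s t : ℝ}
    (hs : 0 ≤ s) (hst : s ≤ t) (ht : t ≤ 1) :
    edist (γ s) (γ t) ≤ pathELength (𝓡 d) γ s t := by
  rw [IsRiemannianManifold.out (I := 𝓡 d)]
  exact riemannianEDist_le_pathELength (hγ.mono (Icc_subset_Icc hs ht)) rfl rfl hst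

/-- On a Riemannian manifold, a locally `K`-Lipschitz map is `K`-Lipschitz. -/
lemma lipschitzWith_of_lipschitzNear (d : ℕ) {M : Type*} [MetricSpace M]
    [ChartedSpace (EuclideanSpace ℝ (Fin d)) M] [IsManifold (𝓡 d) ∞ M]
    [RiemannianBundle (fun x : M ↦ TangentSpace (𝓡 d) x)] [IsRiemannianManifold (𝓡 d) M]
    {α : Type*} [PseudoEMetricSpace α] {K : ℝ≥0} {h : M → α}
    (hh : ∀ y, LipschitzNear K h y) : LipschitzWith K h := by
  intro x y
  have key : ∀ r, edist x y < r → edist (h x) (h y) ≤ K * r := by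
    intro r hr
    obtain ⟨γ, rfl, rfl, hγ, hlen⟩ := exists_path_of_edist_lt d hr
    have hc : Continuous fun t : unitInterval ↦ γ t := hγ.continuousOn.comp_continuous
      continuous_subtype_val fun t ↦ t.2
    choose U hU hLip using hh
    -- The path is subdivided so that each piece stays in a single set on which `h` is
    -- `K`-Lipschitz.
    obtain ⟨t, ht0, htm, ⟨n, hn⟩, hcov⟩ := exists_monotone_Icc_subset_open_cover_unitInterval
      (c := fun y ↦ (fun t : unitInterval ↦ γ t) ⁻¹' interior (U y))
      (fun y ↦ isOpen_interior.preimage hc)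
      (fun s _ ↦ mem_iUnion.2 ⟨γ s, mem_interior_iff_mem_nhds.2 (hU _)⟩)
    have step : ∀ m, edist (h (γ 0)) (h (γ (t m))) ≤ K * pathELength (𝓡 d) γ 0 (t m) := by
      intro m
      induction m with
      | zero => simp [ht0]
      | succ m ih =>
        obtain ⟨z, hz⟩ := hcov m
        have hle : (t m : ℝ) ≤ t (m + 1) := htm m.le_succ
        have h1 : γ (t m) ∈ U z := interior_subset (hz ⟨le_rfl, htm m.le_succ⟩)
        have h2 : γ (t (m + 1)) ∈ U z := interior_subset (hz ⟨htm m.le_succ, le_rfl⟩)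
        calc edist (h (γ 0)) (h (γ (t (m + 1))))
            ≤ edist (h (γ 0)) (h (γ (t m))) + edist (h (γ (t m))) (h (γ (t (m + 1)))) :=
              edist_triangle _ _ _
          _ ≤ K * pathELength (𝓡 d) γ 0 (t m) + K * pathELength (𝓡 d) γ (t m) (t (m + 1)) := by
              gcongr
              refine (hLip z h1 h2).trans ?_
              gcongr
              exact edist_le_pathELength hγ (t m).2.1 hle (t (m + 1)).2.2
          _ = K * pathELength (𝓡 d) γ 0 (t (m + 1)) := by
              rw [← mul_add, pathELength_add (t m).2.1 hle]
    have := step n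
    rw [hn n le_rfl] at this
    refine this.trans ?_
    gcongr
    exact hlen.le
  exact le_coe_mul_of_forall_gt (edist_lt_top x y) fun r hr _ ↦ key r hr

variable [IsContMDiffRiemannianBundle (𝓡 d) ∞ (EuclideanSpace ℝ (Fin d))
  (fun x : M ↦ TangentSpace (𝓡 d) x)]

lemma isContinuousRiemannianBundle : IsContinuousRiemannianBundle (EuclideanSpace ℝ (Fin d))
    (fun x : M ↦ TangentSpace (𝓡 d) x) := by
  have hM : IsContMDiffRiemannianBundle (𝓡 d) ∞ (EuclideanSpace ℝ (Fin d))
    (fun x : M ↦ TangentSpace (𝓡 d) x) := by assumption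
  obtain ⟨g, hg, h⟩ := hM.exists_contMDiff
  exact ⟨g, hg.continuous, h⟩

/-- The derivative of the chart is the trivialization of the tangent bundle, whose norm is locally
bounded because the metric is continuous. -/
lemma eventually_enorm_mfderiv_chartAt_le (p : M) :
    ∃ C : ℝ≥0, ∀ᶠ y in 𝓝 p, ∀ v : TangentSpace (𝓡 d) y,
      ‖(mfderiv (𝓡 d) (𝓡 d) (chartAt 𝔼 p) y v)‖ₑ ≤ C * ‖v‖ₑ := by
  have : IsContinuousRiemannianBundle (EuclideanSpace ℝ (Fin d))
    (fun x : M ↦ TangentSpace (𝓡 d) x) := isContinuousRiemannianBundle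
  rcases eventually_norm_trivializationAt_lt 𝔼 (fun (x : M) ↦ TangentSpace (𝓡 d) x) p
    with ⟨C, C_pos, hC⟩
  refine ⟨C.toNNReal, ?_⟩
  filter_upwards [hC, (chartAt 𝔼 p).open_source.mem_nhds (mem_chart_source 𝔼 p)] with y hy hys v
  rw [TangentBundle.continuousLinearMapAt_trivializationAt hys] at hy
  have h2 := ContinuousLinearMap.le_of_opNorm_le _ hy.le v
  rw [enorm_tangentSpace_vectorSpace]
  have h3 : ∀ w : 𝔼, ‖w‖ ≤ C * ‖v‖ → ‖w‖ₑ ≤ C.toNNReal * ‖v‖ₑ := fun w hw ↦ by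
    rw [← ofReal_norm w, ← ofReal_norm v]
    refine (ENNReal.ofReal_le_ofReal hw).trans_eq ?_
    rw [ENNReal.ofReal_mul C_pos.le]
    rfl
  exact h3 _ h2

lemma edist_chartAt_le_of_path {p : M} {C : ℝ≥0} {γ : ℝ → M}
    (hγ : ContMDiffOn 𝓘(ℝ) (𝓡 d) 1 γ (Icc 0 1))
    (hs : ∀ t ∈ Icc (0 : ℝ) 1, γ t ∈ (chartAt 𝔼 p).source)
    (hC : ∀ t ∈ Icc (0 : ℝ) 1, ∀ v : TangentSpace (𝓡 d) (γ t),
      ‖(mfderiv (𝓡 d) (𝓡 d) (chartAt 𝔼 p) (γ t) v)‖ₑ ≤ C * ‖v‖ₑ) :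
    edist (chartAt 𝔼 p (γ 0)) (chartAt 𝔼 p (γ 1)) ≤ C * pathELength (𝓡 d) γ 0 1 := by
  set e := chartAt 𝔼 p
  have he := IsManifold.chart_mem_maximalAtlas (I := 𝓡 d) (n := ∞) p
  have hγ' : ContDiffOn ℝ 1 (e ∘ γ) (Icc 0 1) := by
    rw [← contMDiffOn_iff_contDiffOn]
    exact ((contMDiffOn_of_mem_maximalAtlas he).of_le (by simp)).comp hγ hs
  calc edist (e (γ 0)) (e (γ 1)) = ‖(e ∘ γ) 1 - (e ∘ γ) 0‖ₑ := by
        rw [edist_comm, edist_eq_enorm_sub]; rfl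
    _ ≤ ∫⁻ t in Icc (0 : ℝ) 1, ‖derivWithin (e ∘ γ) (Icc 0 1) t‖ₑ :=
        enorm_sub_le_lintegral_derivWithin_Icc_of_contDiffOn_Icc hγ' zero_le_one
    _ ≤ ∫⁻ t in Icc (0 : ℝ) 1, C * ‖mfderivWithin 𝓘(ℝ) (𝓡 d) γ (Icc 0 1) t 1‖ₑ := by
        refine setLIntegral_mono' measurableSet_Icc fun t ht ↦ ?_
        have h1 : mfderivWithin 𝓘(ℝ) (𝓡 d) (e ∘ γ) (Icc 0 1) t =
            (mfderiv (𝓡 d) (𝓡 d) e (γ t)).comp (mfderivWithin 𝓘(ℝ) (𝓡 d) γ (Icc 0 1) t) := by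
          apply mfderiv_comp_mfderivWithin
          · exact (contMDiffAt_of_mem_maximalAtlas he (hs t ht)).mdifferentiableAt (by simp)
          · exact hγ.mdifferentiableOn one_ne_zero t ht
          · rw [uniqueMDiffWithinAt_iff_uniqueDiffWithinAt]
            exact uniqueDiffOn_Icc zero_lt_one _ ht
        have h2 : derivWithin (e ∘ γ) (Icc 0 1) t =
            mfderiv (𝓡 d) (𝓡 d) e (γ t) (mfderivWithin 𝓘(ℝ) (𝓡 d) γ (Icc 0 1) t 1) := by
          rw [← fderivWithin_derivWithin, ← mfderivWithin_eq_fderivWithin]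
          exact DFunLike.congr_fun h1 1
        rw [h2]
        exact enorm_tangentSpace_vectorSpace.symm.trans_le (hC t ht _)
    _ = C * pathELength (𝓡 d) γ 0 1 := by
        rw [lintegral_const_mul' _ _ ENNReal.coe_ne_top,
          pathELength_eq_lintegral_mfderivWithin_Icc]

lemma exists_lipschitzNear_chartAt (p : M) : ∃ C, LipschitzNear C (chartAt 𝔼 p) p := by
  obtain ⟨C, hC⟩ := eventually_enorm_mfderiv_chartAt_le (d := d) p
  obtain ⟨r, hr, hball⟩ := Metric.nhds_basis_eball.mem_iff.1 (Filter.inter_mem hC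
    ((chartAt 𝔼 p).open_source.mem_nhds (mem_chart_source 𝔼 p)))
  -- Points within `r / 3` of `p` are joined by paths shorter than `2 * r / 3`, which therefore stay
  -- in the ball of radius `r`.
  have hr3 : 0 < r / 3 := ENNReal.div_pos hr.ne' (by simp)
  refine ⟨C, Metric.eball p (r / 3), Metric.eball_mem_nhds _ hr3, fun x hx y hy ↦ ?_⟩
  have hxy : edist x y < r / 3 + r / 3 := (edist_triangle_right x y p).trans_lt
    (ENNReal.add_lt_add hx hy)
  have key : ∀ ρ, edist x y < ρ → ρ ≤ r / 3 + r / 3 →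
      edist (chartAt 𝔼 p x) (chartAt 𝔼 p y) ≤ C * ρ := by
    intro ρ hρ hρr
    obtain ⟨γ, rfl, rfl, hγ, hlen⟩ := exists_path_of_edist_lt d hρ
    have hmem : ∀ t ∈ Icc (0 : ℝ) 1, γ t ∈ Metric.eball p r := by
      intro t ht
      rw [Metric.mem_eball]
      calc edist (γ t) p ≤ edist (γ t) (γ 0) + edist (γ 0) p := edist_triangle _ _ _
        _ < (r / 3 + r / 3) + r / 3 := by
            refine ENNReal.add_lt_add ?_ hx
            rw [edist_comm]
            refine lt_of_lt_of_le ?_ hρr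
            refine lt_of_le_of_lt ?_ hlen
            refine (edist_le_pathELength hγ le_rfl ht.1 ht.2).trans ?_
            exact pathELength_mono le_rfl ht.2
        _ = r := ENNReal.add_thirds r
    refine (edist_chartAt_le_of_path hγ (fun t ht ↦ (hball (hmem t ht)).2)
      (fun t ht ↦ (hball (hmem t ht)).1)).trans ?_
    gcongr
  exact le_coe_mul_of_forall_gt hxy key

lemma exists_lipschitzNear_chart {e : OpenPartialHomeomorph M (EuclideanSpace ℝ (Fin d))}
    (he : e ∈ IsManifold.maximalAtlas (𝓡 d) ∞ M) {p : M} (hp : p ∈ e.source) :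
    ∃ C, LipschitzNear C e p := by
  obtain ⟨C, hC⟩ := exists_lipschitzNear_chartAt (d := d) p
  have hp' := mem_chart_source 𝔼 p
  have h1 : ContDiffAt ℝ 1 (e ∘ (chartAt 𝔼 p).symm) (chartAt 𝔼 p p) := by
    refine ContMDiffAt.contDiffAt ?_
    refine ContMDiffAt.comp _ ?_ ((contMDiffAt_symm_of_mem_maximalAtlas
      (IsManifold.chart_mem_maximalAtlas (n := ∞) p) ((chartAt 𝔼 p).map_source hp')).of_le (by simp))
    refine (contMDiffAt_of_mem_maximalAtlas he ?_).of_le (by simp)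
    rwa [(chartAt 𝔼 p).left_inv hp']
  obtain ⟨C', hC'⟩ := ContDiffAt.lipschitzNear h1
  refine ⟨C' * C, (hC'.comp hC).congr ?_⟩
  filter_upwards [(chartAt 𝔼 p).open_source.mem_nhds hp'] with y hy
  simp [(chartAt 𝔼 p).left_inv hy]

end Lipschitz

/-! ### Inverse function theorem, covering property and lifting of paths. -/

section Lifting

open Topology Set Manifold
open scoped NNReal

variable {d : ℕ} {M : Type*} [MetricSpace M]
  [ChartedSpace (EuclideanSpace ℝ (Fin d)) M] [IsManifold (𝓡 d) ∞ M]

local notation "𝔼" => EuclideanSpace ℝ (Fin d)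

/-- The inverse function theorem for self-maps of a manifold. -/
lemma exists_openPartialHomeomorph {f : M → M} (hf : ContMDiff (𝓡 d) (𝓡 d) 1 f) {y : M}
    (hinj : Function.Injective (mfderiv (𝓡 d) (𝓡 d) f y)) :
    ∃ Φ : OpenPartialHomeomorph M M, y ∈ Φ.source ∧ EqOn f Φ Φ.source ∧
      ContMDiffAt (𝓡 d) (𝓡 d) 1 Φ.symm (f y) := by
  set e := chartAt 𝔼 y
  set e' := chartAt 𝔼 (f y)
  have hy : y ∈ e.source := mem_chart_source 𝔼 y
  have hy' : f y ∈ e'.source := mem_chart_source 𝔼 (f y)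
  have he : e ∈ IsManifold.maximalAtlas (𝓡 d) ∞ M := IsManifold.chart_mem_maximalAtlas y
  have he' : e' ∈ IsManifold.maximalAtlas (𝓡 d) ∞ M := IsManifold.chart_mem_maximalAtlas (f y)
  have hc : ContDiffAt ℝ 1 (e' ∘ f ∘ e.symm) (e y) := by
    refine ContMDiffAt.contDiffAt ?_
    refine ContMDiffAt.comp _ ?_ (ContMDiffAt.comp _ (hf _)
      ((contMDiffAt_symm_of_mem_maximalAtlas he (e.map_source hy)).of_le (by simp)))
    refine (contMDiffAt_of_mem_maximalAtlas he' ?_).of_le (by simp)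
    simpa [e.left_inv hy] using hy'
  have hD : mfderiv (𝓡 d) (𝓡 d) f y = fderiv ℝ (e' ∘ f ∘ e.symm) (e y) := by
    rw [((hf y).mdifferentiableAt one_ne_zero).mfderiv]
    simp only [ModelWithCorners.range_eq_univ, fderivWithin_univ]
    rfl
  have hinj' : Function.Injective (fderiv ℝ (e' ∘ f ∘ e.symm) (e y)) := hD ▸ hinj
  let L : 𝔼 ≃L[ℝ] 𝔼 := (LinearEquiv.ofInjectiveEndo
    (fderiv ℝ (e' ∘ f ∘ e.symm) (e y)).toLinearMap hinj').toContinuousLinearEquiv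
  have hL : HasFDerivAt (e' ∘ f ∘ e.symm) (L : 𝔼 →L[ℝ] 𝔼) (e y) :=
    (hc.differentiableAt one_ne_zero).hasFDerivAt
  set Ψ := hc.toOpenPartialHomeomorph (e' ∘ f ∘ e.symm) hL one_ne_zero with hΨ
  have hΨc : (Ψ : 𝔼 → 𝔼) = e' ∘ f ∘ e.symm := hc.toOpenPartialHomeomorph_coe hL one_ne_zero
  have hΨs : e y ∈ Ψ.source := hc.mem_toOpenPartialHomeomorph_source hL one_ne_zero
  have hΨi : ContDiffAt ℝ 1 Ψ.symm ((e' ∘ f ∘ e.symm) (e y)) := hc.to_localInverse hL one_ne_zero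
  -- Off this set `e'.symm` need not undo `e'`, and the composite could differ from `f`.
  have hW : IsOpen (f ⁻¹' e'.source) := e'.open_source.preimage hf.continuous
  set Φ := ((e.trans Ψ).trans e'.symm).restrOpen _ hW with hΦ
  have hsrc : Φ.source = ((e.trans Ψ).trans e'.symm).source ∩ f ⁻¹' e'.source :=
    OpenPartialHomeomorph.restrOpen_source _ _ hW
  refine ⟨Φ, ?_, ?_, ?_⟩
  · rw [hsrc]
    refine ⟨?_, hy'⟩
    simp only [OpenPartialHomeomorph.trans_source, mem_inter_iff, mem_preimage,
      OpenPartialHomeomorph.coe_trans, hΨc, Function.comp_apply, e.left_inv hy]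
    exact ⟨⟨hy, hΨs⟩, e'.map_source hy'⟩
  · intro z hz
    rw [hsrc] at hz
    have hze : z ∈ e.source := hz.1.1.1
    change f z = e'.symm (Ψ (e z))
    rw [hΨc]
    simp only [Function.comp_apply, e.left_inv hze]
    exact (e'.left_inv hz.2).symm
  · change ContMDiffAt (𝓡 d) (𝓡 d) 1 (e.symm ∘ Ψ.symm ∘ e') (f y)
    have h1 : (e' ∘ f ∘ e.symm) (e y) = e' (f y) := by simp [e.left_inv hy]
    have h2 : Ψ.symm (e' (f y)) = e y := by
      rw [← h1, ← hΨc, Ψ.left_inv hΨs]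
    have h3 : ContMDiffAt (𝓡 d) (𝓡 d) 1 e' (f y) :=
      (contMDiffAt_of_mem_maximalAtlas he' hy').of_le (by simp)
    have h4 : ContMDiffAt (𝓡 d) (𝓡 d) 1 Ψ.symm (e' (f y)) := by
      rw [← h1]
      exact ContDiffAt.contMDiffAt hΨi
    have h5 : ContMDiffAt (𝓡 d) (𝓡 d) 1 e.symm ((Ψ.symm ∘ e') (f y)) := by
      rw [Function.comp_apply, h2]
      exact (contMDiffAt_symm_of_mem_maximalAtlas he (e.map_source hy)).of_le (by simp)
    exact ContMDiffAt.comp (f y) h5 (ContMDiffAt.comp (f y) h4 h3)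

lemma isLocalHomeomorph_of_injective_mfderiv {f : M → M} (hf : ContMDiff (𝓡 d) (𝓡 d) 1 f)
    (hinj : ∀ y, Function.Injective (mfderiv (𝓡 d) (𝓡 d) f y)) : IsLocalHomeomorph f :=
  IsLocalHomeomorph.mk f fun y ↦
    let ⟨Φ, hy, hΦ, _⟩ := exists_openPartialHomeomorph hf (hinj y)
    ⟨Φ, hy, hΦ⟩

/-- On a compact Hausdorff space a local homeomorphism is a covering map, so fibres are discrete as
well as compact. -/
lemma finite_fibre {X : Type*} [TopologicalSpace X] [T2Space X] [CompactSpace X] {f : X → X}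
    (hf : IsLocalHomeomorph f) (x : X) : (f ⁻¹' {x}).Finite := by
  have hc : IsCompact (f ⁻¹' {x}) := (isClosed_singleton.preimage hf.continuous).isCompact
  exact hc.finite ⟨(isLocalHomeomorph_iff_isCoveringMap.1 hf x).discreteTopology_fiber⟩

/-- Covering theory yields only continuous lifts, whereas measuring length needs `C^1`. Locally the
lift is `γ` followed by a `C^1` inverse branch. -/
lemma contMDiffOn_of_lift {f : M → M} (hf : ContMDiff (𝓡 d) (𝓡 d) 1 f)
    (hinj : ∀ y, Function.Injective (mfderiv (𝓡 d) (𝓡 d) f y)) {γ Γ : ℝ → M} {s : Set ℝ}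
    (hγ : ContMDiffOn 𝓘(ℝ) (𝓡 d) 1 γ s) (hΓ : ContinuousOn Γ s) (h : ∀ t ∈ s, f (Γ t) = γ t) :
    ContMDiffOn 𝓘(ℝ) (𝓡 d) 1 Γ s := by
  intro t ht
  obtain ⟨Φ, hy, hΦ, hsymm⟩ := exists_openPartialHomeomorph hf (hinj (Γ t))
  rw [h t ht] at hsymm
  have h1 : ContMDiffWithinAt 𝓘(ℝ) (𝓡 d) 1 (Φ.symm ∘ γ) s t :=
    hsymm.comp_contMDiffWithinAt t (hγ t ht)
  have h2 : ∀ r ∈ s, Γ r ∈ Φ.source → Γ r = (Φ.symm ∘ γ) r := by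
    intro r hr hr'
    rw [Function.comp_apply, ← h r hr, hΦ hr', Φ.left_inv hr']
  refine h1.congr_of_eventuallyEq ?_ (h2 t ht hy)
  filter_upwards [hΓ t ht (Φ.open_source.mem_nhds hy), self_mem_nhdsWithin] with r hr hrs
  exact h2 r hrs hr

variable [RiemannianBundle (fun x : M ↦ TangentSpace (𝓡 d) x)]

lemma injective_of_le_norm {f : M → M} {lam : ℝ} (hlam : 0 < lam) {y : M}
    (h : ∀ v : TangentSpace (𝓡 d) y, lam * ‖v‖ ≤ ‖mfderiv (𝓡 d) (𝓡 d) f y v‖) :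
    Function.Injective (mfderiv (𝓡 d) (𝓡 d) f y) := by
  rw [injective_iff_map_eq_zero]
  intro v hv
  have := h v
  rw [hv, norm_zero] at this
  exact norm_le_zero_iff.1 (nonpos_of_mul_nonpos_right this hlam)

lemma mul_pathELength_le {f : M → M} (hf : ContMDiff (𝓡 d) (𝓡 d) 1 f) {lam : ℝ≥0}
    (h : ∀ (x : M) (v : TangentSpace (𝓡 d) x), lam * ‖v‖ ≤ ‖mfderiv (𝓡 d) (𝓡 d) f x v‖)
    {Γ : ℝ → M} (hΓ : ContMDiffOn 𝓘(ℝ) (𝓡 d) 1 Γ (Icc 0 1)) :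
    lam * pathELength (𝓡 d) Γ 0 1 ≤ pathELength (𝓡 d) (f ∘ Γ) 0 1 := by
  rw [pathELength_eq_lintegral_mfderivWithin_Icc, pathELength_eq_lintegral_mfderivWithin_Icc,
    ← lintegral_const_mul' _ _ ENNReal.coe_ne_top]
  refine setLIntegral_mono' measurableSet_Icc fun t ht ↦ ?_
  have h1 : mfderivWithin 𝓘(ℝ) (𝓡 d) (f ∘ Γ) (Icc 0 1) t =
      (mfderiv (𝓡 d) (𝓡 d) f (Γ t)).comp (mfderivWithin 𝓘(ℝ) (𝓡 d) Γ (Icc 0 1) t) := by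
    apply mfderiv_comp_mfderivWithin
    · exact (hf _).mdifferentiableAt one_ne_zero
    · exact hΓ.mdifferentiableOn one_ne_zero t ht
    · rw [uniqueMDiffWithinAt_iff_uniqueDiffWithinAt]
      exact uniqueDiffOn_Icc zero_lt_one _ ht
  have h2 := h (Γ t) (mfderivWithin 𝓘(ℝ) (𝓡 d) Γ (Icc 0 1) t 1)
  have h3 : ‖mfderivWithin 𝓘(ℝ) (𝓡 d) (f ∘ Γ) (Icc 0 1) t 1‖ₑ =
      ‖mfderiv (𝓡 d) (𝓡 d) f (Γ t) (mfderivWithin 𝓘(ℝ) (𝓡 d) Γ (Icc 0 1) t 1)‖ₑ := by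
    rw [h1]
    rfl
  rw [h3, ← ofReal_norm (mfderivWithin 𝓘(ℝ) (𝓡 d) Γ (Icc 0 1) t 1),
    ← ofReal_norm (mfderiv (𝓡 d) (𝓡 d) f (Γ t) (mfderivWithin 𝓘(ℝ) (𝓡 d) Γ (Icc 0 1) t 1)),
    ← ENNReal.ofReal_coe_nnreal, ← ENNReal.ofReal_mul lam.coe_nonneg]
  exact ENNReal.ofReal_le_ofReal h2

variable [IsRiemannianManifold (𝓡 d) M] [CompactSpace M]

/-- Fibres of an expanding map are compared by lifting short paths. -/
lemma exists_injective_fibre_map {f : M → M} (hf : ContMDiff (𝓡 d) (𝓡 d) 1 f) {lam : ℝ≥0}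
    (hlam : 0 < lam)
    (h : ∀ (x : M) (v : TangentSpace (𝓡 d) x), lam * ‖v‖ ≤ ‖mfderiv (𝓡 d) (𝓡 d) f x v‖)
    {x x' : M} {r : ℝ≥0∞} (hr : edist x x' < r) :
    ∃ ι : f ⁻¹' {x} → f ⁻¹' {x'}, Function.Injective ι ∧
      ∀ y : f ⁻¹' {x}, lam * edist (y : M) (ι y : M) ≤ r := by
  have hinj (y : M) : Function.Injective (mfderiv (𝓡 d) (𝓡 d) f y) :=
    injective_of_le_norm (NNReal.coe_pos.2 hlam) (h y)
  have cov : IsCoveringMap f :=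
    isLocalHomeomorph_iff_isCoveringMap.1 (isLocalHomeomorph_of_injective_mfderiv hf hinj)
  obtain ⟨γ, rfl, rfl, hγ, hlen⟩ := exists_path_of_edist_lt d hr
  let g : C(unitInterval, M) := ⟨fun t ↦ γ t, hγ.continuousOn.comp_continuous
      continuous_subtype_val fun t ↦ t.2⟩
  have h0 (y : f ⁻¹' {γ 0}) : g 0 = f y := Eq.symm y.2
  let Γ (y : f ⁻¹' {γ 0}) : C(unitInterval, M) := cov.liftPath g y (h0 y)
  have hΓ (y) (t : unitInterval) : f (Γ y t) = γ t := congrFun (cov.liftPath_lifts g y (h0 y)) t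
  have hΓ0 (y) : Γ y 0 = y := cov.liftPath_zero g y (h0 y)
  refine ⟨fun y ↦ ⟨Γ y 1, hΓ y 1⟩, fun y z hyz ↦ ?_, fun y ↦ ?_⟩
  -- Lifts that agree at the endpoint agree everywhere, hence also at their starting points.
  · have h1 : Γ y 1 = Γ z 1 := congrArg Subtype.val hyz
    have h2 : (Γ y : unitInterval → M) = Γ z := cov.eq_of_comp_eq (Γ y).continuous (Γ z).continuous
      (funext fun t ↦ (hΓ y t).trans (hΓ z t).symm) 1 h1
    exact Subtype.ext ((hΓ0 y).symm.trans ((congrFun h2 0).trans (hΓ0 z)))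
  · set G : ℝ → M := fun t ↦ Γ y (projIcc 0 1 zero_le_one t) with hG
    have hfG : ∀ t ∈ Icc (0 : ℝ) 1, f (G t) = γ t := fun t ht ↦ by
      rw [hG, hΓ, projIcc_of_mem _ ht]
    have hGc : ContMDiffOn 𝓘(ℝ) (𝓡 d) 1 G (Icc 0 1) :=
      contMDiffOn_of_lift hf hinj hγ ((Γ y).continuous.comp continuous_projIcc).continuousOn hfG
    have h4 : edist (G 0) (G 1) ≤ pathELength (𝓡 d) G 0 1 :=
      edist_le_pathELength hGc le_rfl zero_le_one le_rfl
    have h5 : G 0 = y := by simp [hG, hΓ0]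
    have h6 : G 1 = Γ y 1 := by simp [hG]
    rw [h5, h6] at h4
    calc lam * edist (y : M) (Γ y 1) ≤ lam * pathELength (𝓡 d) G 0 1 := by gcongr
      _ ≤ pathELength (𝓡 d) (f ∘ G) 0 1 := mul_pathELength_le hf h hGc
      _ = pathELength (𝓡 d) γ 0 1 := pathELength_congr hfG
      _ ≤ r := hlen.le

end Lifting

/-! ### Uniform distortion of Jacobians. -/

section Distortion

open Topology Set Manifold
open scoped NNReal

lemma contDiff_det {d : ℕ} :
    ContDiff ℝ ∞ fun L : EuclideanSpace ℝ (Fin d) →L[ℝ] EuclideanSpace ℝ (Fin d) ↦ L.det := by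
  let b := (EuclideanSpace.basisFun (Fin d) ℝ).toBasis
  have h : (fun L : EuclideanSpace ℝ (Fin d) →L[ℝ] EuclideanSpace ℝ (Fin d) ↦ L.det) =
      fun L ↦ ∑ σ : Equiv.Perm (Fin d), (Equiv.Perm.sign σ : ℤ) •
        ∏ i, L (EuclideanSpace.single i 1) (σ i) := by
    ext L
    rw [ContinuousLinearMap.det, ← LinearMap.det_toMatrix b, Matrix.det_apply]
    refine Finset.sum_congr rfl fun σ _ ↦ ?_
    congr 1
  rw [h]
  refine ContDiff.sum fun σ _ ↦ ContDiff.const_smul _ (contDiff_prod fun i _ ↦ ?_)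
  have : ContDiff ℝ ∞ fun L : EuclideanSpace ℝ (Fin d) →L[ℝ] EuclideanSpace ℝ (Fin d) ↦
      L (EuclideanSpace.single i 1) := contDiff_id.clm_apply contDiff_const
  exact contDiff_euclidean.1 this (σ i)

variable {d : ℕ} {M : Type*} [MetricSpace M]
  [ChartedSpace (EuclideanSpace ℝ (Fin d)) M] [IsManifold (𝓡 d) ∞ M]

local notation "𝔼" => EuclideanSpace ℝ (Fin d)

variable (d) in
/-- The logarithm of `|det|` is uniformly locally Lipschitz on bounded sets of operators whose
determinants stay away from zero. -/
lemma exists_lipschitzNear_log_det (R : ℝ) {c : ℝ} (hc : 0 < c) :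
    ∃ C, ∀ L : EuclideanSpace ℝ (Fin d) →L[ℝ] EuclideanSpace ℝ (Fin d), ‖L‖ ≤ R → c ≤ |L.det| →
      LipschitzNear C
        (fun L : EuclideanSpace ℝ (Fin d) →L[ℝ] EuclideanSpace ℝ (Fin d) ↦ Real.log L.det) L := by
  have : ProperSpace (𝔼 →L[ℝ] 𝔼) := FiniteDimensional.proper ℝ _
  have hK : IsCompact {L : 𝔼 →L[ℝ] 𝔼 | ‖L‖ ≤ R ∧ c ≤ |L.det|} := by
    refine Metric.isCompact_of_isClosed_isBounded ?_ ?_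
    · exact (isClosed_le continuous_norm continuous_const).inter
        (isClosed_le continuous_const contDiff_det.continuous.abs)
    · exact (Metric.isBounded_closedBall (x := (0 : 𝔼 →L[ℝ] 𝔼)) (r := R)).subset
        fun L hL ↦ by simpa using hL.1
  -- `Real.log` depends only on the absolute value of its argument, so a nonzero determinant of
  -- either sign is allowed.
  obtain ⟨C, hC⟩ := exists_forall_lipschitzNear hK
    (g := fun L : 𝔼 →L[ℝ] 𝔼 ↦ Real.log L.det) fun L hL ↦ by
      refine ContDiffAt.lipschitzNear ?_
      refine ContDiffAt.log (contDiff_det.contDiffAt.of_le (by simp)) ?_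
      exact abs_pos.1 (hc.trans_le hL.2)
  exact ⟨C, fun L h1 h2 ↦ hC L ⟨h1, h2⟩⟩

lemma contDiffAt_coord {e e' : OpenPartialHomeomorph M (EuclideanSpace ℝ (Fin d))}
    (he : e ∈ IsManifold.maximalAtlas (𝓡 d) ∞ M) (he' : e' ∈ IsManifold.maximalAtlas (𝓡 d) ∞ M)
    {f : M → M} (hf : ContMDiff (𝓡 d) (𝓡 d) 2 f) {y : M} (hy : y ∈ e.source)
    (hfy : f y ∈ e'.source) : ContDiffAt ℝ 2 (e' ∘ f ∘ e.symm) (e y) := by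
  refine ContMDiffAt.contDiffAt ?_
  refine ContMDiffAt.comp _ ?_ (ContMDiffAt.comp _ (hf _)
    ((contMDiffAt_symm_of_mem_maximalAtlas he (e.map_source hy)).of_le ENat.LEInfty.out))
  refine (contMDiffAt_of_mem_maximalAtlas he' ?_).of_le ENat.LEInfty.out
  simpa [e.left_inv hy] using hfy

lemma FiniteAtlas.norm_fderiv_coord_le {A : FiniteAtlas d M} {f : M → M} {Γ : ℝ}
    (h : A.c2Norm f ≤ ENNReal.ofReal Γ) {i j : Fin A.size} {y : M} (hy : y ∈ A.piece i)
    (hfy : f y ∈ A.piece j) :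
    ‖fderiv ℝ (A.coord i j f) (A.chart i y)‖₊ ≤ Γ.toNNReal ∧
      ‖fderiv ℝ (fderiv ℝ (A.coord i j f)) (A.chart i y)‖₊ ≤ Γ.toNNReal := by
  have h1 : max ‖iteratedFDeriv ℝ 1 (A.coord i j f) (A.chart i y)‖ₑ
      ‖iteratedFDeriv ℝ 2 (A.coord i j f) (A.chart i y)‖ₑ ≤ ENNReal.ofReal Γ :=
    le_trans (le_iSup_of_le i <| le_iSup_of_le j <| le_iSup_of_le y <| le_iSup_of_le hy <|
      le_iSup (fun _ : f y ∈ A.piece j ↦ _) hfy) h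
  have h2 := (le_max_left _ _).trans h1
  have h3 := (le_max_right _ _).trans h1
  constructor
  · rw [← enorm_le_coe, ← ofReal_norm, ← norm_iteratedFDeriv_one, ofReal_norm]
    exact h2
  · rw [← enorm_le_coe, ← ofReal_norm, ← norm_iteratedFDeriv_one, norm_iteratedFDeriv_fderiv,
      ofReal_norm]
    exact h3

variable [CompactSpace M] [MeasurableSpace M] [BorelSpace M]
  [RiemannianBundle (fun x : M ↦ TangentSpace (𝓡 d) x)]
  [IsContMDiffRiemannianBundle (𝓡 d) ∞ (EuclideanSpace ℝ (Fin d))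
      (fun x : M ↦ TangentSpace (𝓡 d) x)]

lemma exists_lipschitzNear_log_density {e : OpenPartialHomeomorph M (EuclideanSpace ℝ (Fin d))}
    (he : e ∈ IsManifold.maximalAtlas (𝓡 d) ∞ M) {K : Set M} (hK : IsCompact K)
    (hKe : K ⊆ e.source) :
    ∃ C, ∀ y ∈ K, LipschitzNear C (fun u ↦ Real.log (density e.symm u)) (e y) := by
  obtain ⟨C, hC⟩ := exists_forall_lipschitzNear (hK.image_of_continuousOn
      (e.continuousOn.mono hKe)) (g := fun u ↦ Real.log (density e.symm u)) fun u hu ↦ by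
    obtain ⟨y, hy, rfl⟩ := hu
    have hy' := e.map_source (hKe hy)
    have hinj := injective_mfderiv_symm he hy'
    exact ContDiffAt.lipschitzNear
      ((contDiffAt_density (contMDiffAt_symm_of_mem_maximalAtlas he hy') hinj).log
        (density_pos hinj).ne')
  exact ⟨C, fun y hy ↦ hC _ (mem_image_of_mem e hy)⟩

lemma exists_density_bounds {e : OpenPartialHomeomorph M (EuclideanSpace ℝ (Fin d))}
    (he : e ∈ IsManifold.maximalAtlas (𝓡 d) ∞ M) {K : Set M} (hK : IsCompact K)
    (hKe : K ⊆ e.source) :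
    ∃ c C : ℝ, 0 < c ∧ 0 < C ∧ ∀ y ∈ K, c ≤ density e.symm (e y) ∧ density e.symm (e y) ≤ C := by
  have hc : ContinuousOn (fun y ↦ density e.symm (e y)) K := by
    refine ContinuousOn.comp (t := e.target) (g := density e.symm) (fun u hu ↦ ?_)
      (e.continuousOn.mono hKe) fun y hy ↦ e.map_source (hKe hy)
    exact (contDiffAt_density (contMDiffAt_symm_of_mem_maximalAtlas he hu)
      (injective_mfderiv_symm he hu)).continuousAt.continuousWithinAt
  rcases K.eq_empty_or_nonempty with rfl | hne
  · exact ⟨1, 1, by simp⟩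
  obtain ⟨y, hy, hmin⟩ := hK.exists_isMinOn hne hc
  obtain ⟨z, hz, hmax⟩ := hK.exists_isMaxOn hne hc
  have hpos (x) (hx : x ∈ K) : 0 < density e.symm (e x) :=
    density_pos (injective_mfderiv_symm he (e.map_source (hKe hx)))
  exact ⟨_, _, hpos y hy, hpos z hz, fun x hx ↦ ⟨hmin hx, hmax hx⟩⟩

variable [IsRiemannianManifold (𝓡 d) M]

/-- With `F` the coordinate form of `f` and `ρ`, `ρ'` the chart densities, `log J = log ρ' ∘ F + log
|det DF| - log ρ`. The `C^2` bound controls the Lipschitz constants of `F` and `DF`. The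
neighbourhood depends on `f` and `y`, but the constant does not. -/
lemma exists_lipschitzNear_log_absDet_piece (A : FiniteAtlas d M) {lam : ℝ} (hlam : 1 ≤ lam)
    (Γ : ℝ) (i j : Fin A.size) :
    ∃ K, ∀ f ∈ expandingClass A lam Γ, ∀ y ∈ A.piece i, f y ∈ A.piece j →
      LipschitzNear K (fun z ↦ Real.log (absDet d f z)) y := by
  have he := A.chart_mem i
  have he' := A.chart_mem j
  obtain ⟨Ce, hCe⟩ := exists_forall_lipschitzNear (A.isCompact_piece i) (g := A.chart i)
    fun y hy ↦ exists_lipschitzNear_chart he (A.piece_subset i hy)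
  obtain ⟨D, hD⟩ := exists_lipschitzNear_log_density he (A.isCompact_piece i) (A.piece_subset i)
  obtain ⟨D', hD'⟩ := exists_lipschitzNear_log_density he' (A.isCompact_piece j) (A.piece_subset j)
  obtain ⟨c, _, hc, _, hcb⟩ := exists_density_bounds he (A.isCompact_piece i) (A.piece_subset i)
  obtain ⟨_, B, _, hB, hBb⟩ := exists_density_bounds he' (A.isCompact_piece j) (A.piece_subset j)
  -- `c / B` bounds `|det DF|` below: `J ≥ 1`, the source density is at least `c` and the target
  -- density at most `B`.
  obtain ⟨D₂, hD₂⟩ := exists_lipschitzNear_log_det d Γ.toNNReal (div_pos hc hB)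
  refine ⟨(D' * (Γ.toNNReal + 1) + D₂ * (Γ.toNNReal + 1) + D) * Ce, fun f hf y hy hfy ↦ ?_⟩
  obtain ⟨hf2, hfΓ, hfl⟩ := hf
  have hye := A.piece_subset i hy
  have hfye := A.piece_subset j hfy
  set e := A.chart i
  set e' := A.chart j
  set F := e' ∘ f ∘ e.symm with hF
  have hcF : ContDiffAt ℝ 2 F (e y) := contDiffAt_coord he he' hf2 hye hfye
  obtain ⟨hb1, hb2⟩ := FiniteAtlas.norm_fderiv_coord_le hfΓ hy hfy
  change ‖fderiv ℝ F (e y)‖₊ ≤ _ at hb1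
  change ‖fderiv ℝ (fderiv ℝ F) (e y)‖₊ ≤ _ at hb2
  -- A derivative bound at one point gives a Lipschitz bound nearby only for a strictly larger
  -- constant, whence the `+ 1`.
  have hL1 : LipschitzNear (Γ.toNNReal + 1) F (e y) :=
    (hcF.hasStrictFDerivAt two_ne_zero).exists_lipschitzOnWith_of_nnnorm_lt _
      (hb1.trans_lt (lt_add_one _))
  have hL2 : LipschitzNear (Γ.toNNReal + 1) (fderiv ℝ F) (e y) :=
    ((hcF.fderiv_right (m := 1) (by norm_num)).hasStrictFDerivAt
      one_ne_zero).exists_lipschitzOnWith_of_nnnorm_lt _ (hb2.trans_lt (lt_add_one _))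
  have hFy : F (e y) = e' (f y) := by simp [hF, e.left_inv hye]
  have hdiff (z : M) : MDifferentiableAt (𝓡 d) (𝓡 d) f z :=
    (hf2 z).mdifferentiableAt two_ne_zero
  have hone (z : M) : 1 ≤ absDet d f z := one_le_absDet fun v ↦
    (le_mul_of_one_le_left (norm_nonneg v) hlam).trans (hfl z v)
  have hformula {z : M} (hz : z ∈ e.source) (hfz : f z ∈ e'.source) :
      density e'.symm (F (e z)) * |(fderiv ℝ F (e z)).det| = absDet d f z * density e.symm (e z) := by
    have := density_mul_abs_det (f := f) he he' (e.map_source hz) (by rwa [e.left_inv hz])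
      (by rw [e.left_inv hz]; exact hdiff z)
    have hFz : F (e z) = e' (f z) := by simp [hF, e.left_inv hz]
    rw [e.left_inv hz] at this
    rw [hFz]
    exact this
  have hdet : c / B ≤ |(fderiv ℝ F (e y)).det| := by
    rw [div_le_iff₀ hB]
    calc c ≤ 1 * density e.symm (e y) := by simpa using (hcb y hy).1
      _ ≤ absDet d f y * density e.symm (e y) :=
        mul_le_mul_of_nonneg_right (hone y) (density_nonneg _ _)
      _ = density e'.symm (F (e y)) * |(fderiv ℝ F (e y)).det| := (hformula hye hfye).symm
      _ ≤ |(fderiv ℝ F (e y)).det| * B := by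
        rw [mul_comm, hFy]
        exact mul_le_mul_of_nonneg_left (hBb _ hfy).2 (abs_nonneg _)
  have hD'y : LipschitzNear D' (fun u ↦ Real.log (density e'.symm u)) (F (e y)) := by
    rw [hFy]
    exact hD' _ hfy
  have key := (((hD'y.comp hL1).add ((hD₂ _ hb1 hdet).comp hL2)).add (hD y hy).neg).comp
    (hCe y hy)
  refine key.congr ?_
  have hopen : IsOpen (e.source ∩ f ⁻¹' e'.source) :=
    e.open_source.inter (e'.open_source.preimage hf2.continuous)
  filter_upwards [hopen.mem_nhds ⟨hye, hfye⟩] with z hz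
  have h1 := hformula hz.1 hz.2
  have h2 : 0 < density e.symm (e z) :=
    density_pos (injective_mfderiv_symm he (e.map_source hz.1))
  have h3 : 0 < absDet d f z := zero_lt_one.trans_le (hone z)
  have h4 : density e'.symm (F (e z)) * |(fderiv ℝ F (e z)).det| ≠ 0 := by
    rw [h1]
    positivity
  have h5 := congrArg Real.log h1
  rw [Real.log_mul (left_ne_zero_of_mul h4) (right_ne_zero_of_mul h4), Real.log_mul h3.ne' h2.ne',
    Real.log_abs] at h5
  simp only [Function.comp_apply] at h5 ⊢
  linarith

/-- Bounded distortion: the logarithmic Jacobians of the maps in `expandingClass A lam Γ` are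
uniformly Lipschitz. -/
lemma exists_lipschitzWith_log_absDet (A : FiniteAtlas d M) {lam : ℝ} (hlam : 1 ≤ lam) (Γ : ℝ) :
    ∃ K, ∀ f ∈ expandingClass A lam Γ, LipschitzWith K fun y ↦ Real.log (absDet d f y) := by
  choose K hK using fun p : Fin A.size × Fin A.size ↦
    exists_lipschitzNear_log_absDet_piece A hlam Γ p.1 p.2
  -- Only the local constants need be uniform: integration along paths removes the dependence on the
  -- neighbourhoods.
  refine ⟨∑ p, K p, fun f hf ↦ lipschitzWith_of_lipschitzNear d fun y ↦ ?_⟩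
  obtain ⟨i, hi⟩ := mem_iUnion.1 (A.cover.symm ▸ mem_univ y : y ∈ ⋃ i, A.piece i)
  obtain ⟨j, hj⟩ := mem_iUnion.1 (A.cover.symm ▸ mem_univ (f y) : f y ∈ ⋃ i, A.piece i)
  exact (hK (i, j) f hf y hi hj).mono
    (Finset.single_le_sum (f := K) (fun _ _ ↦ zero_le) (Finset.mem_univ (i, j)))

end Distortion

/-! ### The cones of log-Lipschitz functions and the action of the transfer operator. -/

section Cone

open Topology Set Manifold
open scoped NNReal

section MetricSpace

variable {X : Type*} [MetricSpace X] {L : ℝ} {φ : X → ℝ}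

/-- Nonnegative functions whose logarithm is `L`-Lipschitz. -/
def IsLogLipschitz (L : ℝ) (φ : X → ℝ) : Prop :=
  (∀ x, 0 ≤ φ x) ∧ ∀ x x', φ x ≤ Real.exp (L * dist x x') * φ x'

lemma IsLogLipschitz.mono (h : IsLogLipschitz L φ) {L' : ℝ} (hL : L ≤ L') : IsLogLipschitz L' φ :=
  ⟨h.1, fun x x' ↦ (h.2 x x').trans (by gcongr; exact h.1 x')⟩

lemma IsLogLipschitz.continuous (h : IsLogLipschitz L φ) : Continuous φ := by
  rw [continuous_iff_continuousAt]
  intro y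
  have h1 : Filter.Tendsto (fun x ↦ Real.exp (L * dist x y) * φ y) (𝓝 y) (𝓝 (φ y)) := by
    have : Continuous fun x ↦ Real.exp (L * dist x y) * φ y := by fun_prop
    simpa using this.tendsto y
  have h2 : Filter.Tendsto (fun x ↦ Real.exp (-(L * dist y x)) * φ y) (𝓝 y) (𝓝 (φ y)) := by
    have : Continuous fun x ↦ Real.exp (-(L * dist y x)) * φ y := by fun_prop
    simpa using this.tendsto y
  refine tendsto_of_tendsto_of_tendsto_of_le_of_le h2 h1 (fun x ↦ ?_) fun x ↦ h.2 x y
  have := h.2 y x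
  rw [Real.exp_neg]
  exact (inv_mul_le_iff₀ (Real.exp_pos _)).2 this

/-- A positive continuous function on a compact space has a positive minimum `φ z`, above which the
logarithm is `1 / φ z`-Lipschitz. -/
lemma exists_isLogLipschitz [CompactSpace X] [Nonempty X] {K : ℝ≥0} (hφ : LipschitzWith K φ)
    (hpos : ∀ x, 0 < φ x) : ∃ L, IsLogLipschitz L φ := by
  obtain ⟨z, -, hz⟩ := isCompact_univ.exists_isMinOn univ_nonempty hφ.continuous.continuousOn
  have hmin (x) : φ z ≤ φ x := hz (mem_univ x)
  refine ⟨K / φ z, fun x ↦ (hpos x).le, fun x x' ↦ ?_⟩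
  have h1 : φ x ≤ φ x' + K * dist x x' := by
    have := (le_abs_self _).trans (hφ.dist_le_mul x x')
    linarith
  calc φ x ≤ φ x' + K * dist x x' := h1
    _ ≤ φ x' + K * dist x x' * (φ x' / φ z) := add_le_add le_rfl
      (le_mul_of_one_le_right (by positivity) ((one_le_div (hpos z)).2 (hmin x')))
    _ = (K / φ z * dist x x' + 1) * φ x' := by ring
    _ ≤ Real.exp (K / φ z * dist x x') * φ x' :=
      mul_le_mul_of_nonneg_right (Real.add_one_le_exp _) (hpos x').le

/-- Hypothesis `hc` says `c ≤ δ * (φ x - c)`. Thus `E * φ x' - c = E * (φ x' - c) + (E - 1) * c` is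
at most `((1 + δ) * E - δ) * (φ x' - c)`. -/
lemma IsLogLipschitz.sub_const (h : IsLogLipschitz L φ) (hL : 0 ≤ L) {δ c : ℝ} (hδ : 0 ≤ δ)
    (_ : 0 ≤ c) (hc : ∀ x, (1 + δ) * c ≤ δ * φ x) :
    IsLogLipschitz ((1 + δ) * L) fun x ↦ φ x - c := by
  have hle (x) : c ≤ φ x := by
    have h1 := hc x
    by_contra! h2
    nlinarith [h.1 x]
  refine ⟨fun x ↦ sub_nonneg.2 (hle x), fun x x' ↦ ?_⟩
  set E := Real.exp (L * dist x x')
  have hE : 1 ≤ E := Real.one_le_exp (by positivity)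
  -- Bernoulli's inequality for `E ^ (1 + δ)`.
  have hpow : (1 + δ) * E - δ ≤ Real.exp ((1 + δ) * L * dist x x') := by
    have h1 := one_add_mul_self_le_rpow_one_add (s := E - 1) (by linarith) (p := 1 + δ)
      (by linarith)
    have h2 : (1 + (E - 1)) ^ (1 + δ) = Real.exp ((1 + δ) * L * dist x x') := by
      rw [add_sub_cancel, ← Real.exp_mul]
      ring_nf
    rw [h2] at h1
    linarith
  calc φ x - c ≤ E * φ x' - c := by linarith [h.2 x x']
    _ ≤ ((1 + δ) * E - δ) * (φ x' - c) := by
      nlinarith [mul_nonneg (sub_nonneg.2 hE) (sub_nonneg.2 (hc x'))]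
    _ ≤ Real.exp ((1 + δ) * L * dist x x') * (φ x' - c) :=
      mul_le_mul_of_nonneg_right hpow (sub_nonneg.2 (hle x'))

variable [CompactSpace X]

lemma IsLogLipschitz.integral_le [MeasurableSpace X] [OpensMeasurableSpace X] {μ : Measure X}
    [IsFiniteMeasure μ] (h : IsLogLipschitz L φ) (hL : 0 ≤ L) (x : X) :
    ∫ y, φ y ∂μ ≤ Real.exp (L * Metric.diam (univ : Set X)) * φ x * μ.real univ := by
  have h1 (y) : φ y ≤ Real.exp (L * Metric.diam (univ : Set X)) * φ x := by
    refine (h.2 y x).trans (mul_le_mul_of_nonneg_right ?_ (h.1 x))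
    gcongr
    exact Metric.dist_le_diam_of_mem isCompact_univ.isBounded (mem_univ y) (mem_univ x)
  calc ∫ y, φ y ∂μ ≤ ∫ _, Real.exp (L * Metric.diam (univ : Set X)) * φ x ∂μ :=
        integral_mono (h.continuous.integrable_of_hasCompactSupport
          (HasCompactSupport.of_compactSpace φ)) (integrable_const _) h1
    _ = _ := by rw [integral_const, smul_eq_mul, mul_comm]

end MetricSpace


/-- The inductions below apply `f 1` first and then use the shifted sequence, whereas the definition
peels off the last map. -/
lemma composition_succ' {M : Type*} (f : ℕ → M → M) (n : ℕ) :
    composition f (n + 1) = composition (fun i ↦ f (i + 1)) n ∘ f 1 := by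
  induction n with
  | zero => rfl
  | succ n ih =>
    change f (n + 1 + 1) ∘ composition f (n + 1) = _
    rw [ih]
    rfl

variable {d : ℕ} {M : Type*} [MetricSpace M] [CompactSpace M]
  [MeasurableSpace M] [BorelSpace M]
  [ChartedSpace (EuclideanSpace ℝ (Fin d)) M] [IsManifold (𝓡 d) ∞ M]
  [RiemannianBundle (fun x : M ↦ TangentSpace (𝓡 d) x)]
  [IsContMDiffRiemannianBundle (𝓡 d) ∞ (EuclideanSpace ℝ (Fin d))
      (fun x : M ↦ TangentSpace (𝓡 d) x)]
  [IsRiemannianManifold (𝓡 d) M]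

lemma transferOperator_id (φ : M → ℝ) : transferOperator d id φ = φ := by
  ext x
  simp [transferOperator, absDet_id]

lemma transferOperator_sub {f : M → M} {x : M} (hf : (f ⁻¹' {x}).Finite) (φ ψ : M → ℝ) :
    transferOperator d f (fun y ↦ φ y - ψ y) x =
      transferOperator d f φ x - transferOperator d f ψ x := by
  simp only [transferOperator, sub_div]
  exact finsum_mem_sub_distrib _ _ hf

section expandingClass

variable {A : FiniteAtlas d M} {lam Γ : ℝ} {f : M → M}

lemma injective_mfderiv_of_mem_expandingClass (hlam : 0 < lam) (hf : f ∈ expandingClass A lam Γ)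
    (y : M) : Function.Injective (mfderiv (𝓡 d) (𝓡 d) f y) :=
  injective_of_le_norm hlam (hf.2.2 y)

lemma isLocalHomeomorph_of_mem_expandingClass (hlam : 0 < lam) (hf : f ∈ expandingClass A lam Γ) :
    IsLocalHomeomorph f :=
  isLocalHomeomorph_of_injective_mfderiv (hf.1.of_le one_le_two)
    (injective_mfderiv_of_mem_expandingClass hlam hf)

lemma absDet_pos_of_mem_expandingClass (hlam : 1 ≤ lam) (hf : f ∈ expandingClass A lam Γ) (y : M) :
    0 < absDet d f y :=
  zero_lt_one.trans_le <| one_le_absDet fun v ↦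
    (le_mul_of_one_le_left (norm_nonneg v) hlam).trans (hf.2.2 y v)

lemma mdifferentiable_of_mem_expandingClass (hf : f ∈ expandingClass A lam Γ) :
    MDifferentiable (𝓡 d) (𝓡 d) f :=
  hf.1.mdifferentiable two_ne_zero

lemma isLocalHomeomorph_and_mdifferentiable_composition (hlam : 0 < lam) {f : ℕ → M → M}
    (hf : ∀ i, 1 ≤ i → f i ∈ expandingClass A lam Γ) (n : ℕ) :
    IsLocalHomeomorph (composition f n) ∧ MDifferentiable (𝓡 d) (𝓡 d) (composition f n) := by
  induction n with
  | zero => exact ⟨(Homeomorph.refl M).isLocalHomeomorph, mdifferentiable_id⟩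
  | succ n ih =>
    have h := hf (n + 1) (by omega)
    exact ⟨(isLocalHomeomorph_of_mem_expandingClass hlam h).comp ih.1,
      (mdifferentiable_of_mem_expandingClass h).comp ih.2⟩

/-- The transfer operator improves the regularity of logarithms, up to the distortion. -/
lemma IsLogLipschitz.transferOperator (hlam : 1 ≤ lam) (hf : f ∈ expandingClass A lam Γ)
    {K : ℝ≥0} (hK : LipschitzWith K fun y ↦ Real.log (absDet d f y)) {L : ℝ} (hL : 0 ≤ L)
    {φ : M → ℝ} (hφ : IsLogLipschitz L φ) :
    IsLogLipschitz ((L + K) / lam) (transferOperator d f φ) := by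
  have hlam0 : 0 < lam := zero_lt_one.trans_le hlam
  have hJ := absDet_pos_of_mem_expandingClass hlam hf
  have hfin := finite_fibre (isLocalHomeomorph_of_mem_expandingClass hlam0 hf)
  have hg0 (y : M) : 0 ≤ φ y / absDet d f y := div_nonneg (hφ.1 y) (hJ y).le
  have hg : IsLogLipschitz (L + K) fun y ↦ φ y / absDet d f y := by
    refine ⟨hg0, fun y z ↦ ?_⟩
    have h1 : Real.log (absDet d f z) ≤ K * dist y z + Real.log (absDet d f y) := by
      have h := (neg_le_abs _).trans (hK.dist_le_mul y z)
      linarith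
    have h2 : absDet d f z ≤ Real.exp (K * dist y z) * absDet d f y := by
      rwa [← Real.log_le_log_iff (hJ z) (mul_pos (Real.exp_pos _) (hJ y)),
        Real.log_mul (Real.exp_pos _).ne' (hJ y).ne', Real.log_exp]
    rw [div_le_iff₀ (hJ y), add_mul, Real.exp_add]
    calc φ y ≤ Real.exp (L * dist y z) * φ z := hφ.2 y z
      _ = Real.exp (L * dist y z) * (φ z / absDet d f z) * absDet d f z := by
        field_simp [(hJ z).ne']
      _ ≤ Real.exp (L * dist y z) * (φ z / absDet d f z) *
          (Real.exp (K * dist y z) * absDet d f y) :=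
        mul_le_mul_of_nonneg_left h2 (mul_nonneg (Real.exp_pos _).le (hg0 z))
      _ = _ := by ring
  refine ⟨fun x ↦ finsum_nonneg fun y ↦ finsum_nonneg fun _ ↦ hg0 y, fun x x' ↦ ?_⟩
  -- Matched points of the two fibres are within `r / lam`, so corresponding terms compare.
  -- Injectivity of the matching suffices, since unmatched terms over `x'` are nonnegative. Finally
  -- `r` decreases to the distance.
  have key (r : ℝ) (hr : dist x x' < r) : ExpandingMaps.transferOperator d f φ x ≤
      Real.exp ((L + K) / lam * r) * ExpandingMaps.transferOperator d f φ x' := by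
    have hr0 : 0 < r := dist_nonneg.trans_lt hr
    have : Fintype (f ⁻¹' {x}) := (hfin x).fintype
    have : Fintype (f ⁻¹' {x'}) := (hfin x').fintype
    have hfib : ∀ (x : M) [Fintype (f ⁻¹' {x})], ExpandingMaps.transferOperator d f φ x =
        ∑ y : f ⁻¹' {x}, φ y / absDet d f y := fun x _ ↦ by
      rw [ExpandingMaps.transferOperator, ← finsum_set_coe_eq_finsum_mem, finsum_eq_sum_of_fintype]
    obtain ⟨ι, hι, hd⟩ := exists_injective_fibre_map (hf.1.of_le one_le_two)
      (lam := ⟨lam, hlam0.le⟩) hlam0 hf.2.2 (x := x) (x' := x') (r := ENNReal.ofReal r)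
      (by rw [edist_dist]; exact (ENNReal.ofReal_lt_ofReal_iff hr0).2 hr)
    have hd' (y : f ⁻¹' {x}) : dist (y : M) (ι y) ≤ r / lam := by
      rw [le_div_iff₀' hlam0, ← ENNReal.ofReal_le_ofReal_iff hr0.le, ENNReal.ofReal_mul hlam0.le,
        ← edist_dist]
      refine le_trans (le_of_eq ?_) (hd y)
      congr 1
      exact ENNReal.ofReal_eq_coe_nnreal hlam0.le
    rw [hfib, hfib]
    calc ∑ y : f ⁻¹' {x}, φ y / absDet d f y
        ≤ ∑ y : f ⁻¹' {x}, Real.exp ((L + K) / lam * r) * (φ (ι y) / absDet d f (ι y)) := by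
          refine Finset.sum_le_sum fun y _ ↦ (hg.2 y (ι y)).trans
            (mul_le_mul_of_nonneg_right (Real.exp_le_exp.2 ?_) (hg0 _))
          rw [div_mul_eq_mul_div, ← mul_div_assoc']
          exact mul_le_mul_of_nonneg_left (hd' y) (by positivity)
      _ = Real.exp ((L + K) / lam * r) * ∑ y : f ⁻¹' {x}, φ (ι y) / absDet d f (ι y) :=
          (Finset.mul_sum _ _ _).symm
      _ ≤ Real.exp ((L + K) / lam * r) * ∑ y : f ⁻¹' {x'}, φ y / absDet d f y := by
          refine mul_le_mul_of_nonneg_left ?_ (Real.exp_pos _).le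
          refine (Finset.sum_map Finset.univ ⟨ι, hι⟩
            (fun y : f ⁻¹' {x'} ↦ φ (y : M) / absDet d f (y : M))).symm.trans_le ?_
          exact Finset.sum_le_sum_of_subset_of_nonneg (Finset.subset_univ _) fun y _ _ ↦ hg0 y
  have hc : Continuous fun r : ℝ ↦
      Real.exp ((L + K) / lam * r) * ExpandingMaps.transferOperator d f φ x' := by fun_prop
  refine ge_of_tendsto ((hc.tendsto (dist x x')).mono_left nhdsWithin_le_nhds :
    Filter.Tendsto _ (𝓝[>] dist x x') _) ?_
  filter_upwards [self_mem_nhdsWithin] with r hr using key r hr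

lemma IsLogLipschitz.integral_transferOperator (hlam : 1 ≤ lam) (hf : f ∈ expandingClass A lam Γ)
    {K : ℝ≥0} (hK : LipschitzWith K fun y ↦ Real.log (absDet d f y)) {L : ℝ} (hL : 0 ≤ L)
    {φ : M → ℝ} (hφ : IsLogLipschitz L φ) :
    ∫ x, ExpandingMaps.transferOperator d f φ x ∂(riemannianMeasure d : Measure M) =
      ∫ x, φ x ∂(riemannianMeasure d : Measure M) := by
  have hloc := isLocalHomeomorph_of_mem_expandingClass (zero_lt_one.trans_le hlam) hf
  have hpos := absDet_pos_of_mem_expandingClass hlam hf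
  have hJ : absDet d f = fun y ↦ Real.exp (Real.log (absDet d f y)) :=
    funext fun y ↦ (Real.exp_log (hpos y)).symm
  refine ExpandingMaps.integral_transferOperator (mdifferentiable_of_mem_expandingClass hf) hloc
    ?_ hpos (finite_fibre hloc) hφ.continuous hφ.1 (hφ.transferOperator hlam hf hK hL).continuous
  rw [hJ]
  exact (Real.continuous_exp.comp hK.continuous).measurable

lemma transferOperator_composition_succ' (hlam : 0 < lam) {f : ℕ → M → M}
    (hf : ∀ i, 1 ≤ i → f i ∈ expandingClass A lam Γ) (n : ℕ) (φ : M → ℝ) :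
    transferOperator d (composition f (n + 1)) φ =
      transferOperator d (composition (fun i ↦ f (i + 1)) n) (transferOperator d (f 1) φ) := by
  obtain ⟨h1, h2⟩ := isLocalHomeomorph_and_mdifferentiable_composition hlam (f := fun i ↦ f (i + 1))
    (fun i _ ↦ hf (i + 1) (by omega)) n
  rw [composition_succ']
  exact transferOperator_comp h2 (mdifferentiable_of_mem_expandingClass (hf 1 le_rfl))
    (finite_fibre h1) (finite_fibre (isLocalHomeomorph_of_mem_expandingClass hlam (hf 1 le_rfl))) φ

end expandingClass

end Cone

/-! ### Repeated removal of common mass, and entry into the cone. -/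

section MemoryLoss

open Topology Set Manifold
open scoped NNReal

variable {d : ℕ} {M : Type*} [MetricSpace M] [CompactSpace M] [Nonempty M]
  [MeasurableSpace M] [BorelSpace M]
  [ChartedSpace (EuclideanSpace ℝ (Fin d)) M] [IsManifold (𝓡 d) ∞ M]
  [RiemannianBundle (fun x : M ↦ TangentSpace (𝓡 d) x)]
  [IsContMDiffRiemannianBundle (𝓡 d) ∞ (EuclideanSpace ℝ (Fin d))
      (fun x : M ↦ TangentSpace (𝓡 d) x)]
  [IsRiemannianManifold (𝓡 d) M]

lemma IsLogLipschitz.integrable {L : ℝ} {φ : M → ℝ} (h : IsLogLipschitz L φ) :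
    Integrable φ (riemannianMeasure d : Measure M) :=
  h.continuous.integrable_of_hasCompactSupport (HasCompactSupport.of_compactSpace φ)

lemma integral_abs_sub_le {L : ℝ} {φ ψ : M → ℝ} (hφ : IsLogLipschitz L φ)
    (hψ : IsLogLipschitz L ψ) :
    ∫ x, |φ x - ψ x| ∂(riemannianMeasure d : Measure M) ≤
      ∫ x, φ x ∂(riemannianMeasure d : Measure M) +
        ∫ x, ψ x ∂(riemannianMeasure d : Measure M) := by
  rw [← integral_add hφ.integrable hψ.integrable]
  refine integral_mono (hφ.integrable.sub hψ.integrable).abs (hφ.integrable.add hψ.integrable)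
    fun x ↦ ?_
  change |φ x - ψ x| ≤ φ x + ψ x
  have h1 := hφ.1 x
  have h2 := hψ.1 x
  exact abs_le.2 ⟨by linarith, by linarith⟩

variable {A : FiniteAtlas d M} {lam Γ : ℝ} {K : ℝ≥0}

/-- A fixed proportion of the mass of a log-Lipschitz function can be split off as a constant. -/
lemma exists_sub_const {L δ κ : ℝ} (hL : 0 ≤ L) (hδ : 0 ≤ δ)
    (hκ : κ = δ / (1 + δ) * Real.exp (-(L * Metric.diam (univ : Set M)))) {a : ℝ} (ha : 0 ≤ a) :
    ∃ c : ℝ, ∀ φ : M → ℝ, IsLogLipschitz L φ →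
      ∫ x, φ x ∂(riemannianMeasure d : Measure M) = a →
      IsLogLipschitz ((1 + δ) * L) (fun x ↦ φ x - c) ∧
        ∫ x, (φ x - c) ∂(riemannianMeasure d : Measure M) = (1 - κ) * a := by
  set V := (riemannianMeasure d : Measure M).real univ with hV
  have hV0 : 0 ≤ V := measureReal_nonneg
  have hκ0 : 0 ≤ κ := by rw [hκ]; positivity
  -- This constant has mass `κ * a` and depends on `φ` only through its integral, so it serves two
  -- functions of equal mass. If `V = 0`, the mass `a` vanishes too.
  refine ⟨κ * a / V, fun φ hφ hφa ↦ ?_⟩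
  have hle (x : M) : a ≤ Real.exp (L * Metric.diam (univ : Set M)) * φ x * V :=
    hφa ▸ hφ.integral_le hL x
  have hcV : κ * a / V * V = κ * a := by
    rcases hV0.eq_or_lt with h0 | h0
    · have : a = 0 := le_antisymm (by simpa [← h0] using hle (Classical.arbitrary M)) ha
      simp [this]
    · exact div_mul_cancel₀ _ h0.ne'
  refine ⟨hφ.sub_const hL hδ (by positivity) fun x ↦ ?_, ?_⟩
  · have h1 : (1 + δ) * κ = δ * Real.exp (-(L * Metric.diam (univ : Set M))) := by
      rw [hκ]
      field_simp
    have h2 : (1 + δ) * (κ * a / V) =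
        δ * Real.exp (-(L * Metric.diam (univ : Set M))) * (a / V) := by
      rw [← h1]
      ring
    rw [h2, mul_assoc]
    refine mul_le_mul_of_nonneg_left ?_ hδ
    rw [Real.exp_neg, inv_mul_le_iff₀ (Real.exp_pos _)]
    exact div_le_of_le_mul₀ hV0 (mul_nonneg (Real.exp_pos _).le (hφ.1 x)) (hle x)
  · rw [integral_sub hφ.integrable (integrable_const _), hφa, integral_const, smul_eq_mul, ← hV,
      mul_comm V, hcV]
    ring

/-- Exponential loss of memory for densities in an invariant cone. -/
lemma integral_abs_transferOperator_composition_sub_le (hlam : 1 < lam)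
    (hK : ∀ f ∈ expandingClass A lam Γ, LipschitzWith K fun y ↦ Real.log (absDet d f y))
    {L δ κ : ℝ} (hL : 0 ≤ L) (hδ : 0 ≤ δ)
    (hκ : κ = δ / (1 + δ) * Real.exp (-(L * Metric.diam (univ : Set M))))
    (hLδ : ((1 + δ) * L + K) / lam ≤ L) (n : ℕ) :
    ∀ (f : ℕ → M → M) (_ : ∀ i, 1 ≤ i → f i ∈ expandingClass A lam Γ) (a : ℝ) (φ ψ : M → ℝ),
      IsLogLipschitz L φ → IsLogLipschitz L ψ →
      ∫ x, φ x ∂(riemannianMeasure d : Measure M) = a →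
      ∫ x, ψ x ∂(riemannianMeasure d : Measure M) = a →
      Integrable (fun x ↦ transferOperator d (composition f n) φ x -
        transferOperator d (composition f n) ψ x) (riemannianMeasure d : Measure M) ∧
      ∫ x, |transferOperator d (composition f n) φ x - transferOperator d (composition f n) ψ x|
        ∂(riemannianMeasure d : Measure M) ≤ 2 * a * (1 - κ) ^ n := by
  induction n with
  | zero =>
    intro f _ a φ ψ hφ hψ hφa hψa
    simp only [composition, transferOperator_id, pow_zero, mul_one, two_mul]
    refine ⟨hφ.integrable.sub hψ.integrable, ?_⟩
    have := integral_abs_sub_le (d := d) hφ hψ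
    rwa [hφa, hψa] at this
  | succ n ih =>
    intro f hf a φ ψ hφ hψ hφa hψa
    have hlam0 : 0 < lam := zero_lt_one.trans hlam
    have ha : 0 ≤ a := hφa ▸ integral_nonneg hφ.1
    have hf1 := hf 1 le_rfl
    have hL' : 0 ≤ (1 + δ) * L := by positivity
    obtain ⟨c, hc⟩ := exists_sub_const (d := d) hL hδ hκ ha
    have key (χ : M → ℝ) (hχ : IsLogLipschitz L χ)
        (hχa : ∫ x, χ x ∂(riemannianMeasure d : Measure M) = a) :
        IsLogLipschitz L (transferOperator d (f 1) fun x ↦ χ x - c) ∧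
        ∫ x, transferOperator d (f 1) (fun x ↦ χ x - c) x ∂(riemannianMeasure d : Measure M) =
          (1 - κ) * a := by
      obtain ⟨h1, h2⟩ := hc χ hχ hχa
      exact ⟨(h1.transferOperator hlam.le hf1 (hK _ hf1) hL').mono hLδ,
        (h1.integral_transferOperator hlam.le hf1 (hK _ hf1) hL').trans h2⟩
    -- The same constant was removed from both functions, so by linearity it cancels from the
    -- difference.
    have heq (x : M) : transferOperator d (composition f (n + 1)) φ x -
        transferOperator d (composition f (n + 1)) ψ x =
        transferOperator d (composition (fun i ↦ f (i + 1)) n)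
          (transferOperator d (f 1) fun x ↦ φ x - c) x -
        transferOperator d (composition (fun i ↦ f (i + 1)) n)
          (transferOperator d (f 1) fun x ↦ ψ x - c) x := by
      have hfin := finite_fibre (isLocalHomeomorph_and_mdifferentiable_composition hlam0 hf (n + 1)).1 x
      rw [← transferOperator_composition_succ' hlam0 hf,
        ← transferOperator_composition_succ' hlam0 hf]
      have h1 := transferOperator_sub (d := d) hfin φ fun _ ↦ c
      have h2 := transferOperator_sub (d := d) hfin ψ fun _ ↦ c
      rw [h1, h2]
      ring
    simp only [heq]
    obtain ⟨hφ1, hφ2⟩ := key φ hφ hφa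
    obtain ⟨hψ1, hψ2⟩ := key ψ hψ hψa
    obtain ⟨h1, h2⟩ := ih (fun i ↦ f (i + 1)) (fun i _ ↦ hf (i + 1) (by omega)) _ _ _ hφ1 hψ1
      hφ2 hψ2
    exact ⟨h1, h2.trans_eq (by ring)⟩

/-- Densities outside of the cone enter it after finitely many steps. -/
lemma integral_abs_transferOperator_composition_sub_le_of_isLogLipschitz (hlam : 1 < lam)
    (hK : ∀ f ∈ expandingClass A lam Γ, LipschitzWith K fun y ↦ Real.log (absDet d f y))
    {Λ : ℝ} (hΛ0 : 0 < Λ) (hΛ1 : Λ < 1)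
    (hΛ : ∀ (n : ℕ) (f : ℕ → M → M), (∀ i, 1 ≤ i → f i ∈ expandingClass A lam Γ) →
      ∀ φ ψ : M → ℝ, IsLogLipschitz (1 + K / (lam - 1)) φ → IsLogLipschitz (1 + K / (lam - 1)) ψ →
      ∫ x, φ x ∂(riemannianMeasure d : Measure M) = 1 →
      ∫ x, ψ x ∂(riemannianMeasure d : Measure M) = 1 →
      Integrable (fun x ↦ transferOperator d (composition f n) φ x -
        transferOperator d (composition f n) ψ x) (riemannianMeasure d : Measure M) ∧
      ∫ x, |transferOperator d (composition f n) φ x - transferOperator d (composition f n) ψ x|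
        ∂(riemannianMeasure d : Measure M) ≤ 2 * Λ ^ n) (N : ℕ) :
    ∀ (n : ℕ) (f : ℕ → M → M), (∀ i, 1 ≤ i → f i ∈ expandingClass A lam Γ) →
      ∀ φ ψ : M → ℝ, IsLogLipschitz (lam ^ N + K / (lam - 1)) φ →
      IsLogLipschitz (lam ^ N + K / (lam - 1)) ψ →
      ∫ x, φ x ∂(riemannianMeasure d : Measure M) = 1 →
      ∫ x, ψ x ∂(riemannianMeasure d : Measure M) = 1 →
      Integrable (fun x ↦ transferOperator d (composition f n) φ x -
        transferOperator d (composition f n) ψ x) (riemannianMeasure d : Measure M) ∧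
      ∫ x, |transferOperator d (composition f n) φ x - transferOperator d (composition f n) ψ x|
        ∂(riemannianMeasure d : Measure M) ≤ 2 * Λ⁻¹ ^ N * Λ ^ n := by
  induction N with
  | zero => simpa using hΛ
  | succ N ih =>
    intro n f hf φ ψ hφ hψ hφ1 hψ1
    cases n with
    -- No map is available to improve the densities, but the trivial bound `2` is enough because
    -- `Λ⁻¹ ≥ 1`.
    | zero =>
      simp only [composition, transferOperator_id, pow_zero, mul_one]
      refine ⟨hφ.integrable.sub hψ.integrable, ?_⟩
      have h1 := integral_abs_sub_le (d := d) hφ hψ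
      have h2 : 1 ≤ Λ⁻¹ ^ (N + 1) := one_le_pow₀ ((one_le_inv₀ hΛ0).2 hΛ1.le)
      rw [hφ1, hψ1] at h1
      linarith
    | succ n =>
      have hlam0 : 0 < lam := zero_lt_one.trans hlam
      have hlam1 : 0 < lam - 1 := sub_pos.2 hlam
      have hf1 := hf 1 le_rfl
      have hL0 : 0 ≤ lam ^ (N + 1) + K / (lam - 1) := by positivity
      -- `K / (lam - 1)` is the fixed point of `L ↦ (L + K) / lam`, and the excess over it is
      -- divided by `lam`. Each such step costs one factor `Λ⁻¹`.
      have hL : (lam ^ (N + 1) + K / (lam - 1) + K) / lam = lam ^ N + K / (lam - 1) := by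
        field_simp
        ring
      have key (χ : M → ℝ) (hχ : IsLogLipschitz (lam ^ (N + 1) + K / (lam - 1)) χ) :
          IsLogLipschitz (lam ^ N + K / (lam - 1)) (transferOperator d (f 1) χ) ∧
          ∫ x, transferOperator d (f 1) χ x ∂(riemannianMeasure d : Measure M) =
            ∫ x, χ x ∂(riemannianMeasure d : Measure M) :=
        ⟨hL ▸ hχ.transferOperator hlam.le hf1 (hK _ hf1) hL0,
          hχ.integral_transferOperator hlam.le hf1 (hK _ hf1) hL0⟩
      rw [transferOperator_composition_succ' hlam0 hf, transferOperator_composition_succ' hlam0 hf]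
      obtain ⟨h1, h2⟩ := ih n (fun i ↦ f (i + 1)) (fun i _ ↦ hf (i + 1) (by omega)) _ _
        (key φ hφ).1 (key ψ hψ).1 ((key φ hφ).2.trans hφ1) ((key ψ hψ).2.trans hψ1)
      refine ⟨h1, h2.trans_eq ?_⟩
      rw [pow_succ Λ⁻¹, pow_succ' Λ, mul_assoc, mul_assoc, mul_assoc, inv_mul_cancel_left₀ hΛ0.ne']

end MemoryLoss

end ExpandingMaps

end

/-! ### Choice of the constants and conclusion. -/

theorem mainTheorem1 (d : ℕ) (M : Type*) [MetricSpace M] [CompactSpace M] [ConnectedSpace M]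
    [MeasurableSpace M] [BorelSpace M]
    [ChartedSpace (EuclideanSpace ℝ (Fin d)) M] [IsManifold (𝓡 d) ∞ M]
    [RiemannianBundle (fun x : M ↦ TangentSpace (𝓡 d) x)]
    [IsContMDiffRiemannianBundle (𝓡 d) ∞ (EuclideanSpace ℝ (Fin d))
      (fun x : M ↦ TangentSpace (𝓡 d) x)]
    [IsRiemannianManifold (𝓡 d) M]
    (A : ExpandingMaps.FiniteAtlas d M) (lam Γ : ℝ) (hlam : 1 < lam) :
    ∃ Λ : ℝ, 0 < Λ ∧ Λ < 1 ∧
      ∀ φ ∈ ExpandingMaps.densityClass d M, ∀ ψ ∈ ExpandingMaps.densityClass d M,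
        ∃ C : ℝ, ∀ f : ℕ → M → M,
          (∀ i, 1 ≤ i → f i ∈ ExpandingMaps.expandingClass A lam Γ) →
          ∀ n : ℕ,
            Integrable (fun x ↦
              ExpandingMaps.transferOperator d (ExpandingMaps.composition f n) φ x -
              ExpandingMaps.transferOperator d (ExpandingMaps.composition f n) ψ x)
              (ExpandingMaps.riemannianMeasure d : Measure M) ∧
            ∫ x, |ExpandingMaps.transferOperator d (ExpandingMaps.composition f n) φ x -
                ExpandingMaps.transferOperator d (ExpandingMaps.composition f n) ψ x|
              ∂(ExpandingMaps.riemannianMeasure d : Measure M) ≤ C * Λ ^ n := by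
  have : Nonempty M := ConnectedSpace.toNonempty
  obtain ⟨K, hK⟩ := ExpandingMaps.exists_lipschitzWith_log_absDet A hlam.le Γ
  have hlam1 : 0 < lam - 1 := sub_pos.2 hlam
  have hK0 : 0 ≤ (K : ℝ) := K.coe_nonneg
  -- Invariance of the cone requires `K ≤ (lam - 1 - δ) * L`. This `δ` leaves half of `lam - 1`, and
  -- the `L` below then meets the condition with room to spare.
  set δ := (lam - 1) / 2 with hδ
  have hδ0 : 0 < δ := half_pos hlam1
  set L := 1 + 2 * (K / (lam - 1)) with hL
  have hL0 : 0 ≤ L := by positivity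
  set κ := δ / (1 + δ) * Real.exp (-(L * Metric.diam (Set.univ : Set M))) with hκ
  have hκ0 : 0 < κ := by positivity
  have hκ1 : κ < 1 := by
    have h1 : δ / (1 + δ) < 1 := (div_lt_one (by linarith)).2 (by linarith)
    have h2 : Real.exp (-(L * Metric.diam (Set.univ : Set M))) ≤ 1 :=
      Real.exp_le_one_iff.2 (neg_nonpos.2 (mul_nonneg hL0 Metric.diam_nonneg))
    exact (mul_le_of_le_one_right (by positivity) h2).trans_lt h1
  have hLδ : ((1 + δ) * L + K) / lam ≤ L := by
    rw [div_le_iff₀ (zero_lt_one.trans hlam)]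
    have h1 : K / (lam - 1) * (lam - 1) = (K : ℝ) := div_mul_cancel₀ _ hlam1.ne'
    rw [hδ, hL]
    linarith
  refine ⟨1 - κ, by linarith, by linarith, fun φ hφ ψ hψ ↦ ?_⟩
  obtain ⟨hφ0, hφ1, Kφ, hφK⟩ := hφ
  obtain ⟨hψ0, hψ1, Kψ, hψK⟩ := hψ
  obtain ⟨Lφ, hφL⟩ := ExpandingMaps.exists_isLogLipschitz hφK hφ0
  obtain ⟨Lψ, hψL⟩ := ExpandingMaps.exists_isLogLipschitz hψK hψ0
  -- Only here do the densities enter: they fix the waiting time `N`, after the rate has been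
  -- chosen.
  obtain ⟨N, hN⟩ := pow_unbounded_of_one_lt (max Lφ Lψ) hlam
  have hKl : 0 ≤ K / (lam - 1) := by positivity
  refine ⟨2 * (1 - κ)⁻¹ ^ N, fun f hf n ↦ ?_⟩
  refine ExpandingMaps.integral_abs_transferOperator_composition_sub_le_of_isLogLipschitz hlam hK
    (by linarith) (by linarith) (fun n f hf φ ψ hφ hψ hφ1 hψ1 ↦ ?_) N n f hf φ ψ
    (hφL.mono ?_) (hψL.mono ?_) hφ1 hψ1
  · have hle : 1 + K / (lam - 1) ≤ L := by linarith
    simpa using ExpandingMaps.integral_abs_transferOperator_composition_sub_le hlam hK hL0 hδ0.le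
      hκ hLδ n f hf 1 φ ψ (hφ.mono hle) (hψ.mono hle) hφ1 hψ1
  · linarith [le_max_left Lφ Lψ]
  · linarith [le_max_right Lφ Lψ]
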